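/- For $c\in\mathbb{R}$ let $\mathbb{H}_c=L^2(\mathbb{R},e^{-2ct}\,dt)$ (complex-valued functions), and let $\partial_c f=f'$ be the unbounded normal operator on $\mathbb{H}_c$ with domain $D(\partial_c)=\{f\in\mathbb{H}_c : f \text{ is locally absolutely continuous and } f'\in\mathbb{H}_c\}$. For Borel measurable $\varphi:\mathbb{C}\to\mathbb{C}$ let $\varphi(\partial_c)=\int\varphi\,dE$ be given by the measurable functional calculus, where $E$ is the spectral measure of $\partial_c$; in particular $\zeta(\partial_c)$ is defined through the Riemann zeta function and $n^{-\partial_c}$ through $s\mapsto n^{-s}$. The spectral operator $\mathfrak{a}_c$ is $\zeta(\partial_c)$ with domain $D(\mathfrak{a}_c)=\{f\in D(\partial_c) : \zeta(\partial_c)f\in\mathbb{H}_c\}$, that is, the restriction of $\zeta(\partial_c)$ to $D(\partial_c)\cap D(\zeta(\partial_c))$. Assume $c>1$. Then $\mathfrak{a}_c$ extends uniquely to a bounded linear operator on $\mathbb{H}_c$, again denoted $\mathfrak{a}_c$. The operators $\zeta(\partial_c)$ and $n^{-\partial_c}$ $(n\ge 1)$ are bounded and defined on all of $\mathbb{H}_c$,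 and $$\mathfrak{a}_c=\zeta(\partial_c)=\sum_{n=1}^{\infty}n^{-\partial_c},$$ where the series converges in the norm of $\mathcal{B}(\mathbb{H}_c)$. Moreover, for every $f\in\mathbb{H}_c$ and $n\ge1$ one has $(n^{-\partial_c}f)(t)=f(t-\log n)$ for almost every $t$, and $$\mathfrak{a}_c f(t)=\sum_{n=1}^{\infty}f(t-\log n),$$ where the series converges to $\mathfrak{a}_cf$ both in $\mathbb{H}_c$ and, absolutely, for almost every $t\in\mathbb{R}$. -/

import Mathlib

open MeasureTheory Filter Topology
open scoped ENNReal InnerProductSpace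

noncomputable section

/-! ### Spectral measures and functions of an unbounded normal operator -/

/-- A resolution of the identity (projection-valued measure) on a measurable space `α`, acting on
the Hilbert space `H`: orthogonal projections `E(B)`, multiplicative on intersections, with
`E(α) = 1` and strongly countably additive.  Values on non-measurable sets are irrelevant. -/
structure ResolutionOfIdentity (α : Type*) [MeasurableSpace α] (H : Type*)
    [NormedAddCommGroup H] [InnerProductSpace ℂ H] [CompleteSpace H] where
  proj : Set α → H →L[ℂ] H
  isStarProjection : ∀ B, MeasurableSet B → IsStarProjection (proj B)
  proj_univ : proj Set.univ = 1
  proj_inter : ∀ B C, MeasurableSet B → MeasurableSet C → proj (B ∩ C) = proj B * proj C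
  hasSum_proj : ∀ B : ℕ → Set α, (∀ i, MeasurableSet (B i)) →
    Pairwise (Function.onFun Disjoint B) →
    ∀ x, HasSum (fun i => proj (B i) x) (proj (⋃ i, B i) x)

namespace ResolutionOfIdentity

variable {α : Type*} [MeasurableSpace α] {H : Type*}
  [NormedAddCommGroup H] [InnerProductSpace ℂ H] [CompleteSpace H]

theorem inner_proj_eq (E : ResolutionOfIdentity α H) {B : Set α} (hB : MeasurableSet B) (x : H) :
    ⟪x, E.proj B x⟫_ℂ = ((‖E.proj B x‖ ^ 2 : ℝ) : ℂ) := by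
  have h := E.isStarProjection B hB
  have h1 : E.proj B (E.proj B x) = E.proj B x := by
    have := congrArg (fun T : H →L[ℂ] H => T x) h.isIdempotentElem.eq
    simpa using this
  have h2 : ContinuousLinearMap.adjoint (E.proj B) = E.proj B := h.isSelfAdjoint.star_eq
  calc ⟪x, E.proj B x⟫_ℂ = ⟪x, E.proj B (E.proj B x)⟫_ℂ := by rw [h1]
    _ = ⟪E.proj B x, E.proj B x⟫_ℂ := by
        rw [← ContinuousLinearMap.adjoint_inner_left, h2]
    _ = _ := by rw [inner_self_eq_norm_sq_to_K]; norm_cast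

/-- The finite positive measure `E_{x,x}(B) = ⟪x, E(B) x⟫ = ‖E(B) x‖²`. -/
def scalarMeasure (E : ResolutionOfIdentity α H) (x : H) : Measure α :=
  Measure.ofMeasurable (fun B _ => ENNReal.ofReal (‖E.proj B x‖ ^ 2))
    (by
      have h := (E.hasSum_proj (fun _ => ∅) (fun _ => MeasurableSet.empty)
        (fun _ _ _ => disjoint_bot_left) x).summable
      have h0 : E.proj ∅ x = 0 := tendsto_nhds_unique tendsto_const_nhds h.tendsto_atTop_zero
      simp [h0])
    (by
      intro B hB hd
      have h := (E.hasSum_proj B hB hd x).mapL (innerSL ℂ x)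
      simp only [innerSL_apply_apply] at h
      rw [E.inner_proj_eq (MeasurableSet.iUnion hB)] at h
      simp only [E.inner_proj_eq (hB _)] at h
      have h' := Complex.hasSum_ofReal.mp h
      rw [← h'.tsum_eq, ENNReal.ofReal_tsum_of_nonneg (fun _ => by positivity) h'.summable])

/-- `T = ∫ φ dE`: the domain of `T` consists of the `x` with `∫ |φ|² dE_{x,x} < ∞`, and
`⟪x, T x⟫ = ∫ φ dE_{x,x}` there.  As this domain is a dense complex subspace, polarization shows
that these two conditions determine `T`. -/
def IsSpectralIntegral (E : ResolutionOfIdentity α H) (φ : α → ℂ) (T : H →ₗ.[ℂ] H) : Prop :=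
  (∀ x : H, x ∈ T.domain ↔ MemLp φ 2 (E.scalarMeasure x)) ∧
    ∀ x : T.domain, ⟪(x : H), T x⟫_ℂ = ∫ a, φ a ∂(E.scalarMeasure x)

end ResolutionOfIdentity

open Classical in
/-- The measurable functional calculus `φ(A) = ∫ φ dE`, where `E` is the spectral measure of `A`,
that is, the resolution of the identity on `ℂ` with `A = ∫ λ dE(λ)`.  For `A` normal and `φ` Borel,
`E` and `φ(A)` exist and are unique; the value `⊥` (the operator with domain `{0}`) is only assigned
where there is no such `E` or no such integral. -/
def functionOfOperator {H : Type*} [NormedAddCommGroup H] [InnerProductSpace ℂ H] [CompleteSpace H]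
    (A : H →ₗ.[ℂ] H) (φ : ℂ → ℂ) : H →ₗ.[ℂ] H :=
  if h : ∃ T : H →ₗ.[ℂ] H, ∃ E : ResolutionOfIdentity ℂ H,
      E.IsSpectralIntegral (fun s => s) A ∧ E.IsSpectralIntegral φ T
  then h.choose else ⊥

/-! ### The weighted Hilbert space, the infinitesimal shift and the spectral operator -/

/-- The measure `e^{-2ct} dt` on the real line. -/
def weightMeasure (c : ℝ) : Measure ℝ :=
  volume.withDensity (fun t => ENNReal.ofReal (Real.exp (-2 * c * t)))

/-- The Hilbert space `ℍ_c = L²(ℝ, e^{-2ct} dt)` of complex-valued functions. -/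
abbrev WeightedL2 (c : ℝ) : Type := Lp ℂ 2 (weightMeasure c)

/-- The graph of `∂_c`: pairs `(f, g)` in `ℍ_c × ℍ_c` such that `f` has a locally absolutely
continuous representative `F` with `F' = g` almost everywhere. -/
def shiftGraph (c : ℝ) : Submodule ℂ (WeightedL2 c × WeightedL2 c) where
  carrier := {p | ∃ F : ℝ → ℂ, p.1 =ᵐ[weightMeasure c] F ∧
    (∀ a b : ℝ, AbsolutelyContinuousOnInterval F a b) ∧
    ∀ᵐ t ∂(weightMeasure c), HasDerivAt F (p.2 t) t}
  zero_mem' := by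
    refine ⟨0, Lp.coeFn_zero _ _ _, fun a b => ?_, ?_⟩
    · exact ((contDiff_const (c := (0 : ℂ))).contDiffOn).absolutelyContinuousOnInterval
    · filter_upwards [Lp.coeFn_zero ℂ 2 (weightMeasure c)] with t ht
      have : (0 : WeightedL2 c × WeightedL2 c).2 t = 0 := by simpa using ht
      rw [this]
      exact hasDerivAt_const t 0
  add_mem' := by
    rintro p q ⟨F, hF, hFa, hFd⟩ ⟨G, hG, hGa, hGd⟩
    refine ⟨F + G, ?_, fun a b => (hFa a b).add (hGa a b), ?_⟩
    · exact (Lp.coeFn_add p.1 q.1).trans (hF.add hG)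
    · filter_upwards [hFd, hGd, Lp.coeFn_add p.2 q.2] with t h1 h2 h3
      have : (p + q).2 t = p.2 t + q.2 t := by simpa using h3
      rw [this]
      exact h1.add h2
  smul_mem' := by
    rintro r p ⟨F, hF, hFa, hFd⟩
    refine ⟨r • F, ?_, fun a b => (hFa a b).const_smul r, ?_⟩
    · exact (Lp.coeFn_smul r p.1).trans (hF.const_smul r)
    · filter_upwards [hFd, Lp.coeFn_smul r p.2] with t h1 h3
      have : (r • p).2 t = r • p.2 t := by simpa using h3
      rw [this]
      exact h1.const_smul r

/-- The graph is single-valued: the derivative depends only on the class of `f`. -/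
theorem shiftGraph_singleValued (c : ℝ) (p : WeightedL2 c × WeightedL2 c)
    (hp : p ∈ shiftGraph c) (h0 : p.1 = 0) : p.2 = 0 := by
  obtain ⟨F, hF, hFa, hFd⟩ := hp
  have hac : volume ≪ weightMeasure c :=
    withDensity_absolutelyContinuous' (by fun_prop)
      (Eventually.of_forall fun t => by simp [Real.exp_pos])
  have hcont : Continuous F := by
    rw [continuous_iff_continuousAt]
    intro t
    refine (hFa (t - 1) (t + 1)).continuousOn.continuousAt ?_
    rw [Set.uIcc_of_le (by linarith)]
    exact Icc_mem_nhds (by linarith) (by linarith)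
  have hz : F =ᵐ[weightMeasure c] 0 := by
    rw [h0] at hF
    exact hF.symm.trans (Lp.coeFn_zero _ _ _)
  have hF0 : F = 0 := (hcont.ae_eq_iff_eq volume continuous_zero).mp (hac.ae_le hz)
  refine Lp.ext ?_
  filter_upwards [hFd, Lp.coeFn_zero ℂ 2 (weightMeasure c)] with t ht hzt
  rw [hF0] at ht
  rw [hzt]
  exact ht.unique (hasDerivAt_const t 0)

/-- The infinitesimal shift `∂_c f = f'` with domain
`{f ∈ ℍ_c ∩ AC(ℝ) : f' ∈ ℍ_c}`, an unbounded operator on `ℍ_c`. -/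
def infinitesimalShift (c : ℝ) : WeightedL2 c →ₗ.[ℂ] WeightedL2 c :=
  (shiftGraph c).toLinearPMap

/-- The spectral operator `𝔞_c`: the operator `ζ(∂_c)` on the domain
`{f ∈ D(∂_c) : ζ(∂_c) f ∈ ℍ_c}`. -/
def spectralOperator (c : ℝ) : WeightedL2 c →ₗ.[ℂ] WeightedL2 c :=
  (functionOfOperator (infinitesimalShift c) riemannZeta).domRestrict (infinitesimalShift c).domain

/-- A bounded operator, defined everywhere, seen as a partially defined operator. -/
def boundedAsPartial {H : Type*} [NormedAddCommGroup H] [InnerProductSpace ℂ H]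
    (T : H →L[ℂ] H) : H →ₗ.[ℂ] H :=
  (T : H →ₗ[ℂ] H).toPMap ⊤

end

/-! The unitary $W f=\mathcal F(e^{-ct}f)$ from $\mathbb H_c$ onto $L^2(\mathbb R)$ carries
$\partial_c$ to multiplication by $c+2\pi i\xi$ (`mem_shiftGraph_iff`). Hence
$E(B)=W^{-1}1_{\{c+2\pi i\xi\in B\}}W$ is a spectral measure of $\partial_c$, carried by the line
$\mathrm{Re}\,s=c$. There $|n^{-s}|=n^{-c}$, so for $c>1$ the Dirichlet series of $\zeta$ converges
uniformly, and integrating it term by term gives $\zeta(\partial_c)=\sum n^{-\partial_c}$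
(`isSpectralIntegral_zetaShift`). On the Fourier side $n^{-s}=e^{-s\log n}$ is the symbol of
translation by $\log n$, an operator of norm at most $n^{-c}$ on $\mathbb H_c$. This yields
convergence in operator norm and, since $\sum\|n^{-\partial_c}f\|<\infty$, absolute convergence
almost everywhere (`hasSum_translates`). Since $\zeta(\partial_c)$ is defined everywhere, $\mathfrak
a_c$ has the dense domain $D(\partial_c)$, and a bounded extension is unique (`eq_of_eqOn_domain`).

The functional calculus refers to an arbitrary spectral measure $E$ of $A$, so the scalar measures
of $E$ must be shown to depend on $A$ alone (`scalarMeasure_eq_of_isSpectralIntegral`). The range of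
$E$ on a ball is detected by the growth of $(A-s_0)^k y$. For any $E$, vectors in the range of
$E(B(s_0,r))$ satisfy $\|(A-s_0)^ky\|\le(2r)^k\|y\|$ (`exists_iterates`); in the multiplication
model such growth forces support where $|m-s_0|\le 2r$ (`multiplicationResolution_proj_closedBall`).
Covering an open set $U$ by small balls gives $E_{x,x}(U)\le F_{x,x}(U)$ for the model measure $F$,
and equal total masses turn this into equality. -/

namespace ResolutionOfIdentity

/-! ### Calculus of projection-valued measures and their scalar measures -/

section General

variable {α : Type*} [MeasurableSpace α] {H : Type*}
  [NormedAddCommGroup H] [InnerProductSpace ℂ H] [CompleteSpace H]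

theorem scalarMeasure_apply (E : ResolutionOfIdentity α H) (x : H) {B : Set α}
    (hB : MeasurableSet B) : E.scalarMeasure x B = ENNReal.ofReal (‖E.proj B x‖ ^ 2) :=
  Measure.ofMeasurable_apply B hB

theorem proj_proj (E : ResolutionOfIdentity α H) {B C : Set α} (hB : MeasurableSet B)
    (hC : MeasurableSet C) (x : H) : E.proj B (E.proj C x) = E.proj (B ∩ C) x := by
  rw [E.proj_inter B C hB hC]; rfl

theorem proj_empty (E : ResolutionOfIdentity α H) (x : H) : E.proj ∅ x = 0 :=
  tendsto_nhds_unique tendsto_const_nhds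
    (E.hasSum_proj (fun _ => ∅) (fun _ => MeasurableSet.empty)
      (fun _ _ _ => disjoint_bot_left) x).summable.tendsto_atTop_zero

theorem inner_proj_left (E : ResolutionOfIdentity α H) {B : Set α} (hB : MeasurableSet B)
    (x y : H) : ⟪E.proj B x, y⟫_ℂ = ⟪x, E.proj B y⟫_ℂ := by
  have h2 : ContinuousLinearMap.adjoint (E.proj B) = E.proj B :=
    (E.isStarProjection B hB).isSelfAdjoint.star_eq
  rw [← ContinuousLinearMap.adjoint_inner_left, h2]

theorem scalarMeasure_univ (E : ResolutionOfIdentity α H) (x : H) :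
    E.scalarMeasure x Set.univ = ENNReal.ofReal (‖x‖ ^ 2) := by
  rw [E.scalarMeasure_apply x MeasurableSet.univ, E.proj_univ]; rfl

instance (E : ResolutionOfIdentity α H) (x : H) : IsFiniteMeasure (E.scalarMeasure x) :=
  ⟨by rw [E.scalarMeasure_univ]; exact ENNReal.ofReal_lt_top⟩

theorem scalarMeasure_proj (E : ResolutionOfIdentity α H) (x : H) {B : Set α}
    (hB : MeasurableSet B) :
    E.scalarMeasure (E.proj B x) = (E.scalarMeasure x).restrict B := by
  ext C hC
  rw [Measure.restrict_apply hC, E.scalarMeasure_apply _ hC, E.scalarMeasure_apply _ (hC.inter hB),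
    E.proj_proj hC hB]

theorem proj_compl_of_proj_eq_zero (E : ResolutionOfIdentity α H) {B : Set α}
    (hB : MeasurableSet B) {x : H} (hx : E.proj B x = 0) : E.proj Bᶜ x = x := by
  -- Finite additivity for $B$ and its complement is countable additivity padded with empty sets.
  have h := (E.hasSum_proj (fun n => if n = 0 then B else if n = 1 then Bᶜ else ∅)
    (by intro i; split_ifs <;> measurability)
    (by
      intro i j hij
      simp only [Function.onFun]
      split_ifs <;> simp_all [disjoint_compl_right, disjoint_compl_left]) x)
  have h2 := h.unique (hasSum_sum_of_ne_finset_zero (s := {0, 1}) (by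
    intro b hb
    simp only [Finset.mem_insert, Finset.mem_singleton, not_or] at hb
    simp [hb.1, hb.2, E.proj_empty]))
  have h3 : (⋃ n : ℕ, if n = 0 then B else if n = 1 then Bᶜ else ∅) = Set.univ := by
    ext t
    simp only [Set.mem_iUnion, Set.mem_univ, iff_true]
    by_cases ht : t ∈ B
    · exact ⟨0, by simpa using ht⟩
    · exact ⟨1, by simpa using ht⟩
  rw [h3, E.proj_univ] at h2
  simpa [hx] using h2.symm

/-- The projections commute, so $E(C)y$ and $E(C)z$ stay in the ranges of $E(B)$ and $1-E(B)$; they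
are orthogonal and Pythagoras applies. -/
theorem scalarMeasure_add (E : ResolutionOfIdentity α H) {B : Set α} (hB : MeasurableSet B)
    {y z : H} (hy : E.proj B y = y) (hz : E.proj B z = 0) :
    E.scalarMeasure (y + z) = E.scalarMeasure y + E.scalarMeasure z := by
  ext C hC
  rw [Measure.add_apply, E.scalarMeasure_apply _ hC, E.scalarMeasure_apply _ hC,
    E.scalarMeasure_apply _ hC, ← ENNReal.ofReal_add (by positivity) (by positivity)]
  congr 1
  have h0 : ⟪E.proj C y, E.proj C z⟫_ℂ = 0 := by
    rw [← hy, E.proj_proj hC hB, Set.inter_comm, ← E.proj_proj hB hC, E.inner_proj_left hB,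
      E.proj_proj hB hC, Set.inter_comm, ← E.proj_proj hC hB, hz, map_zero, inner_zero_right]
  rw [map_add, sq, sq, sq]
  exact norm_add_sq_eq_norm_sq_add_norm_sq_of_inner_eq_zero _ _ h0

/-- A vector is the sum of its components along a countable measurable partition. -/
theorem hasSum_proj_fiber (E : ResolutionOfIdentity α H) {g : α → ℕ} (hg : Measurable g) (x : H) :
    HasSum (fun n => E.proj (g ⁻¹' {n}) x) x := by
  have h := E.hasSum_proj (fun n => g ⁻¹' {n}) (fun n => hg (measurableSet_singleton n))
    (fun i j hij => Disjoint.preimage g (by simpa using hij)) x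
  have h3 : (⋃ n, g ⁻¹' {n}) = Set.univ := by ext; simp
  rwa [h3, E.proj_univ] at h

end General

/-! ### The operator $\int\lambda\,dE$ on spectral subspaces of bounded sets -/

section Complex

variable {H : Type*} [NormedAddCommGroup H] [InnerProductSpace ℂ H] [CompleteSpace H]
  {E : ResolutionOfIdentity ℂ H} {A : H →ₗ.[ℂ] H}

theorem ae_mem_of_proj_eq {B : Set ℂ} (hB : MeasurableSet B) {y : H} (hy : E.proj B y = y) :
    ∀ᵐ s ∂(E.scalarMeasure y), s ∈ B := by
  rw [← hy, E.scalarMeasure_proj y hB]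
  exact ae_restrict_mem hB

theorem mem_domain_of_proj_eq (hA : E.IsSpectralIntegral (fun s => s) A) {B : Set ℂ}
    (hB : MeasurableSet B) (hbd : Bornology.IsBounded B) {y : H} (hy : E.proj B y = y) :
    y ∈ A.domain := by
  rw [hA.1]
  obtain ⟨R, hR⟩ := hbd.exists_norm_le
  refine MemLp.of_bound measurable_id.aestronglyMeasurable R ?_
  filter_upwards [ae_mem_of_proj_eq hB hy] with s hs using hR s hs

theorem integrable_id (hA : E.IsSpectralIntegral (fun s => s) A) (y : A.domain) :
    Integrable (fun s : ℂ => s) (E.scalarMeasure y) :=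
  ((hA.1 y).1 y.2).integrable (by norm_num)

/-- Only the quadratic form of $A$ is given. Additivity of the scalar measures kills the sum of the
cross terms $\langle y,Az\rangle+\langle z,Ay\rangle$; replacing $z$ by $iz$ kills their difference.
-/
theorem inner_apply_eq_zero (hA : E.IsSpectralIntegral (fun s => s) A) {B : Set ℂ}
    (hB : MeasurableSet B) (y z : A.domain) (hy : E.proj B y = y) (hz : E.proj B z = 0) :
    ⟪(z : H), A y⟫_ℂ = 0 := by
  have key : ∀ w : A.domain, E.proj B w = 0 → ⟪(y : H), A w⟫_ℂ + ⟪(w : H), A y⟫_ℂ = 0 := by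
    intro w hw
    have h1 := hA.2 (y + w)
    have h2 : E.scalarMeasure ((y + w : A.domain) : H) = E.scalarMeasure y + E.scalarMeasure w :=
      E.scalarMeasure_add hB hy hw
    rw [h2, integral_add_measure (integrable_id hA y) (integrable_id hA w), ← hA.2, ← hA.2] at h1
    rw [LinearPMap.map_add, Submodule.coe_add, inner_add_left, inner_add_right,
      inner_add_right] at h1
    linear_combination h1
  have h1 := key z hz
  have h2 := key (Complex.I • z) (by simp [hz])
  rw [LinearPMap.map_smul, Submodule.coe_smul, inner_smul_left, inner_smul_right,
    Complex.conj_I] at h2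
  have h3 := congrArg (fun w => Complex.I * w) h2
  ring_nf at h3
  rw [Complex.I_sq] at h3
  linear_combination (1 / 2 : ℂ) * h1 + (1 / 2 : ℂ) * h3

theorem measurable_floor_norm : Measurable (fun s : ℂ => ⌊‖s‖⌋₊) :=
  Nat.measurable_floor.comp measurable_norm

theorem isBounded_floor_norm (n : ℕ) : Bornology.IsBounded ((fun s : ℂ => ⌊‖s‖⌋₊) ⁻¹' {n}) := by
  refine (Metric.isBounded_closedBall (x := (0 : ℂ)) (r := n + 1)).subset ?_
  intro s hs
  have : ⌊‖s‖⌋₊ = n := hs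
  rw [mem_closedBall_zero_iff, ← this]
  exact (Nat.lt_floor_add_one _).le

/-- The ranges of the spectral projections are invariant under `A`. -/
theorem proj_apply_eq (hA : E.IsSpectralIntegral (fun s => s) A) {B : Set ℂ}
    (hB : MeasurableSet B) (y : A.domain) (hy : E.proj B y = y) :
    E.proj B (A y) = A y := by
  rw [← compl_compl B]
  refine E.proj_compl_of_proj_eq_zero hB.compl ?_
  -- The component of $Ay$ in the complement need not lie in the domain. It is cut into pieces over
  -- bounded sets, which do, and each piece is orthogonal to $Ay$, hence to itself.
  have hs := E.hasSum_proj_fiber measurable_floor_norm (E.proj Bᶜ (A y))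
  refine hs.unique ?_
  convert hasSum_zero with n
  have hm : MeasurableSet ((fun s : ℂ => ⌊‖s‖⌋₊) ⁻¹' {n}) :=
    measurable_floor_norm (measurableSet_singleton n)
  rw [E.proj_proj hm hB.compl]
  set C := (fun s : ℂ => ⌊‖s‖⌋₊) ⁻¹' {n} ∩ Bᶜ with hC
  have hCm : MeasurableSet C := hm.inter hB.compl
  have hCC : E.proj C (E.proj C (A y)) = E.proj C (A y) := by
    rw [E.proj_proj hCm hCm, Set.inter_self]
  have hd : E.proj C (A y) ∈ A.domain := mem_domain_of_proj_eq hA hCm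
    ((isBounded_floor_norm n).subset Set.inter_subset_left) hCC
  have h0 := inner_apply_eq_zero hA hB y ⟨_, hd⟩ hy (by
    have : B ∩ C = ∅ := by
      rw [hC]; ext t; simp only [Set.mem_inter_iff, Set.mem_compl_iff, Set.mem_empty_iff_false]
      tauto
    change E.proj B (E.proj C (A y)) = 0
    rw [E.proj_proj hB hCm, this, E.proj_empty])
  have h1 : ⟪E.proj C (A y), E.proj C (A y)⟫_ℂ = 0 := by
    rw [← E.inner_proj_left hCm, hCC]; exact h0
  exact inner_self_eq_zero.1 h1

/-- A numerical-radius bound: the form of $A-s_0$ at $y$ is the integral of $s-s_0$ against a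
measure of mass $\|y\|^2$ carried by $B$. -/
theorem norm_inner_apply_sub_le (hA : E.IsSpectralIntegral (fun s => s) A) {B : Set ℂ}
    (hB : MeasurableSet B) {s₀ : ℂ} {r : ℝ} (hBr : B ⊆ Metric.closedBall s₀ r) (y : A.domain)
    (hy : E.proj B y = y) : ‖⟪(y : H), A y - s₀ • (y : H)⟫_ℂ‖ ≤ r * ‖(y : H)‖ ^ 2 := by
  have h1 : ⟪(y : H), A y - s₀ • (y : H)⟫_ℂ = ∫ s, (s - s₀) ∂(E.scalarMeasure y) := by
    rw [integral_sub (integrable_id hA y) (integrable_const _), ← hA.2, inner_sub_right,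
      inner_smul_right, integral_const, measureReal_def, E.scalarMeasure_univ,
      ENNReal.toReal_ofReal (by positivity), inner_self_eq_norm_sq_to_K]
    simp [mul_comm]
  rw [h1]
  have h2 := norm_integral_le_of_norm_le_const (μ := E.scalarMeasure y) (f := fun s => s - s₀)
    (C := r) (by
      filter_upwards [ae_mem_of_proj_eq hB hy] with s hs
      simpa [dist_eq_norm] using hBr hs)
  rwa [measureReal_def, E.scalarMeasure_univ, ENNReal.toReal_ofReal (by positivity)] at h2

/-- Polarization turns the numerical-radius bound into a norm bound at the cost of a factor 2. The
loss is harmless, since the balls used later can be shrunk. -/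
theorem norm_apply_sub_le (hA : E.IsSpectralIntegral (fun s => s) A) {B : Set ℂ}
    (hB : MeasurableSet B) {s₀ : ℂ} {r : ℝ} (hr : 0 < r) (hBr : B ⊆ Metric.closedBall s₀ r)
    (y : A.domain) (hy : E.proj B y = y) : ‖A y - s₀ • (y : H)‖ ≤ 2 * r * ‖(y : H)‖ := by
  have hbd : Bornology.IsBounded B := Metric.isBounded_closedBall.subset hBr
  set w := A y - s₀ • (y : H) with hw
  have hwB : E.proj B w = w := by rw [hw, map_sub, map_smul, proj_apply_eq hA hB y hy, hy]
  have hwD : w ∈ A.domain := mem_domain_of_proj_eq hA hB hbd hwB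
  -- Polarization gives $t\|w\|^2\le r(\|y\|^2+t^2\|w\|^2)$ for $z=tw$; $t=1/(2r)$ maximizes
  -- $t-rt^2$.
  set t : ℂ := ((1 / (2 * r) : ℝ) : ℂ) with ht
  set z : A.domain := t • ⟨w, hwD⟩ with hz
  have hzB : E.proj B z = z := by simp [hz, hwB]
  have hzc : (z : H) = t • w := rfl
  have key : ∀ a : ℂ, ‖a‖ = 1 →
      ‖⟪(y : H) + a • (z : H), A y + a • A z - s₀ • ((y : H) + a • (z : H))⟫_ℂ‖ ≤
      r * ‖(y : H) + a • (z : H)‖ ^ 2 := by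
    intro a ha
    have := norm_inner_apply_sub_le hA hB hBr (y + a • z) (by simp [hy, hzB])
    simpa [LinearPMap.map_add, LinearPMap.map_smul] using this
  have hpol : (4 : ℂ) * ⟪(z : H), w⟫_ℂ =
      ⟪(y : H) + (1 : ℂ) • (z : H), A y + (1 : ℂ) • A z - s₀ • ((y : H) + (1 : ℂ) • (z : H))⟫_ℂ
      - ⟪(y : H) + (-1 : ℂ) • (z : H),
          A y + (-1 : ℂ) • A z - s₀ • ((y : H) + (-1 : ℂ) • (z : H))⟫_ℂ
      + Complex.I * ⟪(y : H) + Complex.I • (z : H),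
          A y + Complex.I • A z - s₀ • ((y : H) + Complex.I • (z : H))⟫_ℂ
      - Complex.I * ⟪(y : H) + (-Complex.I) • (z : H),
          A y + (-Complex.I) • A z - s₀ • ((y : H) + (-Complex.I) • (z : H))⟫_ℂ := by
    rw [hw]
    simp only [inner_add_left, inner_add_right, inner_sub_right, inner_smul_left, inner_smul_right,
      map_neg, map_one, Complex.conj_I]
    ring_nf
    simp only [Complex.I_sq]
    ring
  have k1 := key 1 (by simp)
  have k2 := key (-1) (by simp)
  have k3 := key Complex.I (by simp)
  have k4 := key (-Complex.I) (by simp)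
  have hpar1 := parallelogram_law_with_norm ℂ (y : H) (z : H)
  have hpar2 := parallelogram_law_with_norm ℂ (y : H) (Complex.I • (z : H))
  have hI : ‖Complex.I • (z : H)‖ = ‖(z : H)‖ := by rw [norm_smul]; simp
  rw [hI] at hpar2
  have h4 : ‖(4 : ℂ) * ⟪(z : H), w⟫_ℂ‖ ≤ 4 * r * (‖(y : H)‖ ^ 2 + ‖(z : H)‖ ^ 2) := by
    rw [hpol]
    refine (norm_sub_le _ _).trans ((add_le_add ((norm_add_le _ _).trans
      (add_le_add (norm_sub_le _ _) le_rfl)) le_rfl).trans ?_)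
    rw [norm_mul, norm_mul, Complex.norm_I, one_mul, one_mul]
    refine (add_le_add (add_le_add (add_le_add k1 k2) k3) k4).trans ?_
    simp only [one_smul, neg_smul, ← sub_eq_add_neg]
    nlinarith
  have hzn : ‖(z : H)‖ = 1 / (2 * r) * ‖w‖ := by
    rw [hzc, norm_smul, ht, Complex.norm_real, Real.norm_of_nonneg (by positivity)]
  have hzi : ‖(4 : ℂ) * ⟪(z : H), w⟫_ℂ‖ = 4 * (1 / (2 * r) * ‖w‖ ^ 2) := by
    rw [hzc, inner_smul_left, inner_self_eq_norm_sq_to_K, ht, Complex.conj_ofReal]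
    simp [abs_of_pos hr]
  rw [hzi, hzn] at h4
  have h5 : ‖w‖ ^ 2 ≤ (2 * r * ‖(y : H)‖) ^ 2 := by
    have e1 : 4 * (1 / (2 * r) * ‖w‖ ^ 2) = 2 * ‖w‖ ^ 2 / r := by field_simp; ring
    have e2 : 4 * r * (‖(y : H)‖ ^ 2 + (1 / (2 * r) * ‖w‖) ^ 2) =
        (4 * r ^ 2 * ‖(y : H)‖ ^ 2 + ‖w‖ ^ 2) / r := by field_simp; ring
    rw [e1, e2, div_le_div_iff_of_pos_right hr] at h4
    nlinarith
  exact (pow_le_pow_iff_left₀ (norm_nonneg _) (by positivity) two_ne_zero).1 h5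

/-- Powers of `A - s₀` are geometrically bounded on spectral subspaces of small balls. -/
theorem exists_iterates (hA : E.IsSpectralIntegral (fun s => s) A) {B : Set ℂ}
    (hB : MeasurableSet B) {s₀ : ℂ} {r : ℝ} (hr : 0 < r) (hBr : B ⊆ Metric.closedBall s₀ r)
    {y : H} (hy : E.proj B y = y) :
    ∃ u : ℕ → A.domain, (u 0 : H) = y ∧ (∀ k, (u (k + 1) : H) = A (u k) - s₀ • (u k : H)) ∧
      ∀ k, ‖(u k : H)‖ ≤ (2 * r) ^ k * ‖y‖ := by
  have hbd : Bornology.IsBounded B := Metric.isBounded_closedBall.subset hBr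
  have hstep : ∀ z : A.domain, E.proj B z = z →
      E.proj B (A z - s₀ • (z : H)) = A z - s₀ • (z : H) := by
    intro z hz
    rw [map_sub, map_smul, proj_apply_eq hA hB z hz, hz]
  let u : ℕ → {z : A.domain // E.proj B z = z} := fun n => Nat.rec
    ⟨⟨y, mem_domain_of_proj_eq hA hB hbd hy⟩, hy⟩
    (fun _ z => ⟨⟨A z.1 - s₀ • (z.1 : H),
      mem_domain_of_proj_eq hA hB hbd (hstep z.1 z.2)⟩, hstep z.1 z.2⟩) n
  refine ⟨fun n => (u n).1, rfl, fun k => rfl, fun k => ?_⟩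
  induction k with
  | zero => simp [u]
  | succ k ih =>
    have h1 : ‖((u (k + 1)).1 : H)‖ ≤ 2 * r * ‖((u k).1 : H)‖ :=
      norm_apply_sub_le hA hB hr hBr (u k).1 (u k).2
    calc _ ≤ _ := h1
      _ ≤ 2 * r * ((2 * r) ^ k * ‖y‖) := by gcongr
      _ = _ := by ring

end Complex

end ResolutionOfIdentity

/-! ### Uniqueness of the scalar spectral measures -/

theorem MeasureTheory.Measure.eq_of_forall_isOpen_le {X : Type*} [TopologicalSpace X]
    [MeasurableSpace X] [BorelSpace X] {μ ν : Measure X} [IsFiniteMeasure μ] [ν.OuterRegular]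
    (h : ∀ U, IsOpen U → μ U ≤ ν U) (huniv : μ Set.univ = ν Set.univ) : μ = ν := by
  -- Outer regularity passes the bound from open sets to all sets; equal finite total mass then
  -- forces equality.
  refine Measure.eq_of_le_of_measure_univ_eq (Measure.le_iff'.2 fun s => ?_) huniv
  rw [s.measure_eq_iInf_isOpen ν]
  exact le_iInf₂ fun U hU => le_iInf fun hUo => (measure_mono hU).trans (h U hUo)

namespace ResolutionOfIdentity

variable {H : Type*} [NormedAddCommGroup H] [InnerProductSpace ℂ H] [CompleteSpace H]
  {E F : ResolutionOfIdentity ℂ H} {A : H →ₗ.[ℂ] H}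

/-- If vectors on which the powers of `A - s₀` grow at most like `r ^ k` lie in the range of
`F (closedBall s₀ r)`, then the scalar measures of any spectral measure of `A` are those of `F`. -/
theorem scalarMeasure_eq_of_isSpectralIntegral (hA : E.IsSpectralIntegral (fun s => s) A)
    (hF : ∀ (s₀ : ℂ) (r : ℝ), 0 < r → ∀ u : ℕ → A.domain,
      (∀ k, (u (k + 1) : H) = A (u k) - s₀ • (u k : H)) →
      (∀ k, ‖(u k : H)‖ ≤ r ^ k * ‖(u 0 : H)‖) →
      F.proj (Metric.closedBall s₀ r) (u 0) = u 0) (x : H) :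
    E.scalarMeasure x = F.scalarMeasure x := by
  refine Measure.eq_of_forall_isOpen_le (fun U hU => ?_)
    (by rw [E.scalarMeasure_univ, F.scalarMeasure_univ])
  rcases U.eq_empty_or_nonempty with rfl | hne
  · simp
  have hUm := hU.measurableSet
  -- The doubled ball must stay in $U$ because `exists_iterates` only controls the growth by
  -- $(2r)^k$.
  have hr : ∀ s : U, ∃ r : ℝ, 0 < r ∧ Metric.closedBall (s : ℂ) (2 * r) ⊆ U := by
    intro s
    obtain ⟨ε, hε, h⟩ := Metric.nhds_basis_closedBall.mem_iff.1 (hU.mem_nhds s.2)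
    exact ⟨ε / 2, by positivity, by rwa [mul_div_cancel₀ _ two_ne_zero]⟩
  choose r hr0 hrU using hr
  obtain ⟨T, hT, hTU⟩ := TopologicalSpace.isOpen_iUnion_countable
    (fun s : U => Metric.ball (s : ℂ) (r s)) (fun s => Metric.isOpen_ball)
  have hTU' : ⋃ i ∈ T, Metric.ball (i : ℂ) (r i) = U := by
    rw [hTU]
    refine Set.Subset.antisymm (Set.iUnion_subset fun s => ?_) fun s hs =>
      Set.mem_iUnion.2 ⟨⟨s, hs⟩, Metric.mem_ball_self (hr0 _)⟩
    exact (Metric.ball_subset_closedBall.trans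
      (Metric.closedBall_subset_closedBall (by linarith [hr0 s]))).trans (hrU s)
  have hTne : T.Nonempty := by
    obtain ⟨s, hs⟩ := hne
    rw [← hTU'] at hs
    obtain ⟨i, hi, -⟩ := Set.mem_iUnion₂.1 hs
    exact ⟨i, hi⟩
  obtain ⟨e, rfl⟩ := hT.exists_eq_range hTne
  rw [Set.biUnion_range] at hTU'
  -- A countable partition of $U$ into pieces of the balls, so that countable additivity recovers
  -- $E(U)$.
  set B : ℕ → Set ℂ := disjointed fun n => Metric.ball (e n : ℂ) (r (e n)) with hBdef
  have hBm : ∀ n, MeasurableSet (B n) := fun n =>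
    MeasurableSet.disjointed (fun _ => measurableSet_ball) n
  have hBU : ⋃ n, B n = U := by rw [hBdef, iUnion_disjointed, hTU']
  have hproj : ∀ n z, F.proj U (E.proj (B n) z) = E.proj (B n) z := by
    intro n z
    have hzz : E.proj (B n) (E.proj (B n) z) = E.proj (B n) z := by
      rw [E.proj_proj (hBm n) (hBm n), Set.inter_self]
    obtain ⟨u, hu0, hu, hub⟩ := exists_iterates hA (hBm n) (hr0 (e n))
      ((disjointed_subset _ n).trans Metric.ball_subset_closedBall) hzz
    have h := hF (e n) (2 * r (e n)) (by linarith [hr0 (e n)]) u hu (by rwa [hu0])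
    rw [hu0] at h
    rw [← h, F.proj_proj hUm measurableSet_closedBall, Set.inter_eq_right.2 (hrU (e n))]
  have hle : ∀ z, F.proj U (E.proj U z) = E.proj U z := by
    intro z
    have h1 := E.hasSum_proj B hBm (disjoint_disjointed _) z
    have h2 := h1.mapL (F.proj U)
    simp only [hproj] at h2
    rw [hBU] at h1 h2
    exact h2.unique h1
  -- The adjoint of $F(U)E(U)=E(U)$; it gives $\|E(U)x\|=\|E(U)F(U)x\|\le\|F(U)x\|$.
  have hle' : ∀ z, E.proj U (F.proj U z) = E.proj U z := by
    intro z
    refine ext_inner_right ℂ fun w => ?_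
    rw [E.inner_proj_left hUm, F.inner_proj_left hUm, hle, E.inner_proj_left hUm]
  rw [E.scalarMeasure_apply x hUm, F.scalarMeasure_apply x hUm, ← hle']
  gcongr
  have h3 := (E.isStarProjection U hUm).norm_le
  calc _ ≤ ‖E.proj U‖ * ‖F.proj U x‖ := (E.proj U).le_opNorm _
    _ ≤ 1 * ‖F.proj U x‖ := by gcongr
    _ = _ := one_mul _

end ResolutionOfIdentity

/-! ### Identifying $\varphi(A)$ with a bounded operator -/

theorem boundedAsPartial_eq {H : Type*} [NormedAddCommGroup H] [InnerProductSpace ℂ H]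
    {S : H →ₗ.[ℂ] H} {T : H →L[ℂ] H} (hdom : ∀ x, x ∈ S.domain)
    (h : ∀ x : S.domain, ⟪(x : H), S x⟫_ℂ = ⟪(x : H), T x⟫_ℂ) : S = boundedAsPartial T := by
  have htop : S.domain = ⊤ := by ext x; simp [hdom x]
  have hz : (S.toFun.comp (LinearMap.codRestrict S.domain LinearMap.id hdom)) - (T : H →ₗ[ℂ] H)
      = 0 := by
    rw [← inner_map_self_eq_zero]
    intro x
    have := h ⟨x, hdom x⟩
    have h2 : ⟪x, S ⟨x, hdom x⟩ - T x⟫_ℂ = 0 := by rw [inner_sub_right, this, sub_self]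
    rw [← inner_conj_symm, show ((S.toFun.comp (LinearMap.codRestrict S.domain LinearMap.id hdom)) -
      (T : H →ₗ[ℂ] H)) x = S ⟨x, hdom x⟩ - T x from rfl, h2, map_zero]
  refine LinearPMap.ext (by rw [htop]; rfl) ?_
  intro x hx hx'
  have := congrArg (fun L : H →ₗ[ℂ] H => L x) hz
  exact sub_eq_zero.1 this

/-- The chosen operator comes with some unknown $E$, but both conditions of `IsSpectralIntegral` see
$E$ only through its scalar measures. On a complex space the quadratic form then determines the
operator. -/
theorem functionOfOperator_eq_boundedAsPartial {H : Type*} [NormedAddCommGroup H]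
    [InnerProductSpace ℂ H] [CompleteSpace H] {A : H →ₗ.[ℂ] H} {F : ResolutionOfIdentity ℂ H}
    (hA : F.IsSpectralIntegral (fun s => s) A)
    (huniq : ∀ E : ResolutionOfIdentity ℂ H, E.IsSpectralIntegral (fun s => s) A →
      ∀ x, E.scalarMeasure x = F.scalarMeasure x)
    {φ : ℂ → ℂ} {T : H →L[ℂ] H} (hT : F.IsSpectralIntegral φ (boundedAsPartial T)) :
    functionOfOperator A φ = boundedAsPartial T := by
  have hex : ∃ T : H →ₗ.[ℂ] H, ∃ E : ResolutionOfIdentity ℂ H,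
      E.IsSpectralIntegral (fun s => s) A ∧ E.IsSpectralIntegral φ T := ⟨_, F, hA, hT⟩
  rw [functionOfOperator, dif_pos hex]
  obtain ⟨E, hE, hφ⟩ := hex.choose_spec
  have hmem : ∀ x, x ∈ (boundedAsPartial T).domain := fun x => Submodule.mem_top
  refine boundedAsPartial_eq (fun x => ?_) fun x => ?_
  · rw [hφ.1, huniq E hE, ← hT.1]
    exact hmem x
  · rw [hφ.2, huniq E hE, ← hT.2 ⟨x, hmem x⟩]
    rfl

noncomputable section

/-! ### Multiplication by indicators on $L^2$ -/

section Indicator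

variable {X : Type*} [MeasurableSpace X] {μ : Measure X}

/-- Multiplication by the indicator of a measurable set, as an operator on `L²`. -/
def indicatorL2 (μ : Measure X) {S : Set X} (hS : MeasurableSet S) :
    Lp ℂ 2 μ →L[ℂ] Lp ℂ 2 μ :=
  LinearMap.mkContinuous
    { toFun := fun f => ((Lp.memLp f).indicator hS).toLp _
      map_add' := by
        intro f g
        refine Lp.ext ?_
        refine (MemLp.coeFn_toLp _).trans ?_
        filter_upwards [Lp.coeFn_add f g, Lp.coeFn_add (((Lp.memLp f).indicator hS).toLp _)
          (((Lp.memLp g).indicator hS).toLp _), ((Lp.memLp f).indicator hS).coeFn_toLp,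
          ((Lp.memLp g).indicator hS).coeFn_toLp] with t h1 h2 h3 h4
        rw [h2, Pi.add_apply, h3, h4]
        by_cases ht : t ∈ S
        · simp only [Set.indicator_of_mem ht, h1, Pi.add_apply]
        · simp only [Set.indicator_of_notMem ht, add_zero]
      map_smul' := by
        intro a f
        refine Lp.ext ?_
        refine (MemLp.coeFn_toLp _).trans ?_
        filter_upwards [Lp.coeFn_smul a f, Lp.coeFn_smul a (((Lp.memLp f).indicator hS).toLp _),
          ((Lp.memLp f).indicator hS).coeFn_toLp] with t h1 h2 h3
        rw [RingHom.id_apply, h2, Pi.smul_apply, h3]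
        by_cases ht : t ∈ S
        · simp only [Set.indicator_of_mem ht, h1, Pi.smul_apply]
        · simp only [Set.indicator_of_notMem ht, smul_zero] }
    1 (by
      intro f
      rw [one_mul]
      refine Lp.norm_le_norm_of_ae_le ?_
      filter_upwards [((Lp.memLp f).indicator hS).coeFn_toLp] with t h
      simp only [LinearMap.coe_mk, AddHom.coe_mk]
      rw [h]
      exact norm_indicator_le_norm_self _ _)

theorem indicatorL2_congr {S T : Set X} (hS : MeasurableSet S) (hT : MeasurableSet T)
    (h : S = T) : indicatorL2 μ hS = indicatorL2 μ hT := by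
  subst h; rfl

theorem coeFn_indicatorL2 {S : Set X} (hS : MeasurableSet S) (f : Lp ℂ 2 μ) :
    indicatorL2 μ hS f =ᵐ[μ] S.indicator f :=
  ((Lp.memLp f).indicator hS).coeFn_toLp

theorem norm_sq_eq_lintegral (f : Lp ℂ 2 μ) :
    ENNReal.ofReal (‖f‖ ^ 2) = ∫⁻ t, ‖f t‖ₑ ^ 2 ∂μ := by
  rw [Lp.norm_def, ← ENNReal.toReal_pow, ENNReal.ofReal_toReal (by
    exact ENNReal.pow_ne_top (Lp.memLp f).2.ne),
    eLpNorm_eq_lintegral_rpow_enorm_toReal (by norm_num) (by norm_num), ENNReal.toReal_ofNat,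
    ← ENNReal.rpow_natCast, ← ENNReal.rpow_mul]
  norm_num

theorem norm_sq_indicatorL2 {S : Set X} (hS : MeasurableSet S) (f : Lp ℂ 2 μ) :
    ENNReal.ofReal (‖indicatorL2 μ hS f‖ ^ 2) = ∫⁻ t in S, ‖f t‖ₑ ^ 2 ∂μ := by
  rw [norm_sq_eq_lintegral, ← lintegral_indicator hS]
  refine lintegral_congr_ae ?_
  filter_upwards [coeFn_indicatorL2 hS f] with t h
  rw [h]
  by_cases ht : t ∈ S <;> simp [ht]

theorem hasSum_indicatorL2 {S : ℕ → Set X} (hS : ∀ n, MeasurableSet (S n))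
    (hd : Pairwise (Function.onFun Disjoint S)) (f : Lp ℂ 2 μ) :
    HasSum (fun n => indicatorL2 μ (hS n) f) (indicatorL2 μ (MeasurableSet.iUnion hS) f) := by
  have hfin : ∫⁻ t, ‖f t‖ₑ ^ 2 ∂μ ≠ ∞ := by
    rw [← norm_sq_eq_lintegral]; exact ENNReal.ofReal_ne_top
  have hsub : ∀ s : Finset ℕ, ENNReal.ofReal (‖indicatorL2 μ (MeasurableSet.iUnion hS) f -
      ∑ n ∈ s, indicatorL2 μ (hS n) f‖ ^ 2) =
      ∫⁻ t in (⋃ n, S n) \ ⋃ n ∈ s, S n, ‖f t‖ₑ ^ 2 ∂μ := by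
    intro s
    rw [norm_sq_eq_lintegral, ← lintegral_indicator
      ((MeasurableSet.iUnion hS).diff (s.measurableSet_biUnion fun n _ => hS n))]
    refine lintegral_congr_ae ?_
    filter_upwards [coeFn_indicatorL2 (MeasurableSet.iUnion hS) f,
      Lp.coeFn_sub (indicatorL2 μ (MeasurableSet.iUnion hS) f) (∑ n ∈ s, indicatorL2 μ (hS n) f),
      Lp.coeFn_finsetSum s (fun n => indicatorL2 μ (hS n) f),
      ae_all_iff.2 fun n => coeFn_indicatorL2 (hS n) f] with t h1 h2 h3 h4
    rw [h2, Pi.sub_apply, h3, h1, Finset.sum_apply]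
    simp only [h4]
    rw [← Finset.indicator_biUnion_apply s S (fun i _ j _ hij => hd hij)]
    by_cases ht : t ∈ ⋃ n ∈ s, S n
    · have ht' : t ∈ ⋃ n, S n := by
        obtain ⟨i, -, hi⟩ := Set.mem_iUnion₂.1 ht
        exact Set.mem_iUnion.2 ⟨i, hi⟩
      rw [Set.indicator_of_mem ht, Set.indicator_of_mem ht',
        Set.indicator_of_notMem (by simp only [Set.mem_sdiff, not_and, not_not]; exact fun _ => ht)]
      simp
    · rw [Set.indicator_of_notMem ht]
      by_cases ht' : t ∈ ⋃ n, S n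
      · rw [Set.indicator_of_mem ht', Set.indicator_of_mem (Set.mem_sdiff_of_mem ht' ht), sub_zero]
      · rw [Set.indicator_of_notMem ht', Set.indicator_of_notMem fun h => ht' h.1]
        simp
  -- The squared error is the mass of the uncovered part under the finite measure $|f|^2\mu$; these
  -- parts decrease to the empty set along finite index sets.
  have hlim : Tendsto (fun s : Finset ℕ => ∫⁻ t in (⋃ n, S n) \ ⋃ n ∈ s, S n, ‖f t‖ₑ ^ 2 ∂μ)
      atTop (𝓝 0) := by
    set ν := μ.withDensity (fun t => ‖f t‖ₑ ^ 2) with hν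
    have hfinν : IsFiniteMeasure ν := isFiniteMeasure_withDensity hfin
    have h := tendsto_measure_iInter_atTop (μ := ν)
      (s := fun s : Finset ℕ => (⋃ n, S n) \ ⋃ n ∈ s, S n)
      (fun s => ((MeasurableSet.iUnion hS).diff
        (s.measurableSet_biUnion fun n _ => hS n)).nullMeasurableSet)
      (fun s t hst => Set.sdiff_subset_sdiff_right (Set.biUnion_subset_biUnion_left hst))
      ⟨∅, measure_ne_top _ _⟩
    have he : ⋂ s : Finset ℕ, (⋃ n, S n) \ ⋃ n ∈ s, S n = ∅ := by
      ext t
      simp only [Set.mem_iInter, Set.mem_sdiff, Set.mem_iUnion, Set.mem_empty_iff_false, iff_false]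
      intro h
      obtain ⟨n, hn⟩ := (h ∅).1
      exact (h {n}).2 ⟨n, by simp, hn⟩
    rw [he, measure_empty] at h
    refine h.congr fun s => ?_
    rw [Function.comp_apply, hν, withDensity_apply _ ((MeasurableSet.iUnion hS).diff
      (s.measurableSet_biUnion fun n _ => hS n))]
  have h2 : Tendsto (fun s : Finset ℕ => ‖indicatorL2 μ (MeasurableSet.iUnion hS) f -
      ∑ n ∈ s, indicatorL2 μ (hS n) f‖ ^ 2) atTop (𝓝 0) := by
    have := (ENNReal.tendsto_toReal ENNReal.zero_ne_top).comp hlim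
    refine this.congr fun s => ?_
    rw [Function.comp_apply, ← hsub, ENNReal.toReal_ofReal (by positivity)]
  have h3 := h2.sqrt
  simp only [Real.sqrt_zero, Real.sqrt_sq (norm_nonneg _)] at h3
  rw [HasSum, SummationFilter.unconditional_filter, tendsto_iff_norm_sub_tendsto_zero]
  simpa only [norm_sub_rev] using h3

end Indicator

/-! ### The spectral measure of a multiplication operator -/

section Multiplication

variable {X : Type*} [MeasurableSpace X] {μ : Measure X} {H : Type*} [NormedAddCommGroup H]
  [InnerProductSpace ℂ H] [CompleteSpace H]

open Classical in
/-- The resolution of the identity of the operator that a unitary `W` carries to multiplication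
by `m` on `L²(μ)`. -/
def multiplicationResolution (W : H ≃ₗᵢ[ℂ] Lp ℂ 2 μ) {m : X → ℂ} (hm : Measurable m) :
    ResolutionOfIdentity ℂ H where
  proj B := if hB : MeasurableSet B then
    (W.symm : Lp ℂ 2 μ →L[ℂ] H) ∘L indicatorL2 μ (hm hB) ∘L (W : H →L[ℂ] Lp ℂ 2 μ) else 0
  isStarProjection B hB := by
    rw [dif_pos hB]
    refine ⟨?_, ?_⟩
    · ext x
      change W.symm (indicatorL2 μ (hm hB) (W (W.symm (indicatorL2 μ (hm hB) (W x))))) =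
        W.symm (indicatorL2 μ (hm hB) (W x))
      rw [W.apply_symm_apply]
      congr 1
      refine Lp.ext ?_
      filter_upwards [coeFn_indicatorL2 (hm hB) (W x),
        coeFn_indicatorL2 (hm hB) (indicatorL2 μ (hm hB) (W x))] with t h1 h2
      rw [h2]
      by_cases ht : t ∈ m ⁻¹' B
      · rw [Set.indicator_of_mem ht]
      · rw [Set.indicator_of_notMem ht, h1, Set.indicator_of_notMem ht]
    · rw [ContinuousLinearMap.isSelfAdjoint_iff_isSymmetric]
      intro x y
      change ⟪W.symm (indicatorL2 μ (hm hB) (W x)), y⟫_ℂ =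
        ⟪x, W.symm (indicatorL2 μ (hm hB) (W y))⟫_ℂ
      rw [← W.inner_map_map, ← W.inner_map_map x, W.apply_symm_apply, W.apply_symm_apply,
        L2.inner_def, L2.inner_def]
      refine integral_congr_ae ?_
      filter_upwards [coeFn_indicatorL2 (hm hB) (W x), coeFn_indicatorL2 (hm hB) (W y)]
        with t h1 h2
      rw [h1, h2]
      by_cases ht : t ∈ m ⁻¹' B
      · rw [Set.indicator_of_mem ht, Set.indicator_of_mem ht]
      · rw [Set.indicator_of_notMem ht, Set.indicator_of_notMem ht]; simp
  proj_univ := by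
    rw [dif_pos MeasurableSet.univ]
    ext x
    change W.symm (indicatorL2 μ (hm MeasurableSet.univ) (W x)) = x
    rw [W.symm_apply_eq]
    refine Lp.ext ?_
    filter_upwards [coeFn_indicatorL2 (hm MeasurableSet.univ) (W x)] with t h1
    rw [h1]; simp
  proj_inter B C hB hC := by
    rw [dif_pos hB, dif_pos hC, dif_pos (hB.inter hC)]
    ext x
    change W.symm (indicatorL2 μ (hm (hB.inter hC)) (W x)) =
      W.symm (indicatorL2 μ (hm hB) (W (W.symm (indicatorL2 μ (hm hC) (W x)))))
    rw [W.apply_symm_apply]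
    congr 1
    refine Lp.ext ?_
    filter_upwards [coeFn_indicatorL2 (hm hC) (W x), coeFn_indicatorL2 (hm (hB.inter hC)) (W x),
      coeFn_indicatorL2 (hm hB) (indicatorL2 μ (hm hC) (W x))] with t h1 h2 h3
    rw [h3, h2]
    by_cases ht : t ∈ m ⁻¹' B
    · rw [Set.indicator_of_mem ht, h1]
      by_cases ht' : t ∈ m ⁻¹' C
      · rw [Set.indicator_of_mem ht', Set.indicator_of_mem (show t ∈ m ⁻¹' (B ∩ C) from ⟨ht, ht'⟩)]
      · rw [Set.indicator_of_notMem ht',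
          Set.indicator_of_notMem (show t ∉ m ⁻¹' (B ∩ C) from fun h => ht' h.2)]
    · rw [Set.indicator_of_notMem ht,
        Set.indicator_of_notMem (show t ∉ m ⁻¹' (B ∩ C) from fun h => ht h.1)]
  hasSum_proj B hB hd x := by
    simp only [dif_pos (hB _)]
    rw [dif_pos (MeasurableSet.iUnion hB)]
    have h := hasSum_indicatorL2 (μ := μ) (fun n => hm (hB n))
      (fun i j hij => (hd hij).preimage m) (W x)
    have h2 := h.mapL (W.symm : Lp ℂ 2 μ →L[ℂ] H)
    rw [← indicatorL2_congr (hm (MeasurableSet.iUnion hB)) _ Set.preimage_iUnion] at h2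
    exact h2

theorem map_multiplicationResolution_proj (W : H ≃ₗᵢ[ℂ] Lp ℂ 2 μ) {m : X → ℂ} (hm : Measurable m)
    {B : Set ℂ} (hB : MeasurableSet B) (x : H) :
    W ((multiplicationResolution W hm).proj B x) = indicatorL2 μ (hm hB) (W x) := by
  simp only [multiplicationResolution, dif_pos hB]
  exact W.apply_symm_apply _

theorem multiplicationResolution_scalarMeasure (W : H ≃ₗᵢ[ℂ] Lp ℂ 2 μ) {m : X → ℂ}
    (hm : Measurable m) (x : H) :
    (multiplicationResolution W hm).scalarMeasure x =
      (μ.withDensity (fun t => ‖W x t‖ₑ ^ 2)).map m := by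
  ext B hB
  rw [ResolutionOfIdentity.scalarMeasure_apply _ _ hB, Measure.map_apply hm hB,
    withDensity_apply _ (hm hB), ← norm_sq_indicatorL2 (hm hB), ← W.norm_map,
    map_multiplicationResolution_proj W hm hB]

theorem memLp_two_iff_lintegral {Y : Type*} [MeasurableSpace Y] {ν : Measure Y} {φ : Y → ℂ}
    (hφ : AEStronglyMeasurable φ ν) : MemLp φ 2 ν ↔ ∫⁻ t, ‖φ t‖ₑ ^ 2 ∂ν < ∞ := by
  have h := eLpNorm_lt_top_iff_lintegral_rpow_enorm_lt_top (f := φ) (μ := ν) (p := 2)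
    (by norm_num) (by norm_num)
  simp only [ENNReal.toReal_ofNat, ENNReal.rpow_ofNat] at h
  rw [MemLp, h]
  exact and_iff_right hφ

theorem memLp_multiplicationResolution_iff (W : H ≃ₗᵢ[ℂ] Lp ℂ 2 μ) {m : X → ℂ}
    (hm : Measurable m) {φ : ℂ → ℂ} (hφ : Measurable φ) (x : H) :
    MemLp φ 2 ((multiplicationResolution W hm).scalarMeasure x) ↔
      MemLp (fun t => φ (m t) * W x t) 2 μ := by
  have hW := (Lp.stronglyMeasurable (W x)).measurable
  rw [memLp_two_iff_lintegral hφ.aestronglyMeasurable,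
    memLp_two_iff_lintegral (φ := fun t => φ (m t) * W x t)
      ((hφ.comp hm).mul hW).aestronglyMeasurable,
    multiplicationResolution_scalarMeasure, lintegral_map (by fun_prop) hm,
    lintegral_withDensity_eq_lintegral_mul _ (by fun_prop) (by fun_prop)]
  simp only [enorm_mul, mul_pow, Pi.mul_apply, mul_comm]

/-- The scalar measure at $x$ is the image of $|Wx|^2\mu$ under $m$. Only maximality of the domain
has to be assumed: on the domain, `hT` already makes the product square integrable. -/
theorem multiplicationResolution_isSpectralIntegral (W : H ≃ₗᵢ[ℂ] Lp ℂ 2 μ) {m : X → ℂ}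
    (hm : Measurable m) {φ : ℂ → ℂ} (hφ : Measurable φ) {T : H →ₗ.[ℂ] H}
    (hdom : ∀ x, MemLp (fun t => φ (m t) * W x t) 2 μ → x ∈ T.domain)
    (hT : ∀ x : T.domain, W (T x) =ᵐ[μ] fun t => φ (m t) * W x t) :
    (multiplicationResolution W hm).IsSpectralIntegral φ T := by
  refine ⟨fun x => ?_, fun x => ?_⟩
  · rw [memLp_multiplicationResolution_iff W hm hφ]
    exact ⟨fun hx => (memLp_congr_ae (hT ⟨x, hx⟩)).1 (Lp.memLp _), hdom x⟩
  · have hW := (Lp.stronglyMeasurable (W x)).measurable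
    rw [multiplicationResolution_scalarMeasure, integral_map hm.aemeasurable
      hφ.aestronglyMeasurable, integral_withDensity_eq_integral_toReal_smul (by fun_prop)
      (Eventually.of_forall fun t => by finiteness), ← W.inner_map_map, L2.inner_def]
    refine integral_congr_ae ?_
    filter_upwards [hT x] with t ht
    rw [ht, RCLike.inner_apply, mul_assoc, RCLike.mul_conj]
    simp [mul_comm]

/-- If `A` is carried to multiplication by `m`, vectors on which the powers of `A - s₀` grow at
most like `r ^ k` are supported where `|m - s₀| ≤ r`. -/
theorem multiplicationResolution_proj_closedBall (W : H ≃ₗᵢ[ℂ] Lp ℂ 2 μ) {m : X → ℂ}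
    (hm : Measurable m) {A : H →ₗ.[ℂ] H}
    (hA : ∀ x : A.domain, W (A x) =ᵐ[μ] fun t => m t * W x t)
    {s₀ : ℂ} {r : ℝ} (hr : 0 < r) {u : ℕ → A.domain}
    (hu : ∀ k, (u (k + 1) : H) = A (u k) - s₀ • (u k : H))
    (hb : ∀ k, ‖(u k : H)‖ ≤ r ^ k * ‖(u 0 : H)‖) :
    (multiplicationResolution W hm).proj (Metric.closedBall s₀ r) (u 0) = u 0 := by
  have hpow : ∀ k, W (u k) =ᵐ[μ] fun t => (m t - s₀) ^ k * W (u 0) t := by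
    intro k
    induction k with
    | zero => simp
    | succ k ih =>
      rw [hu, map_sub, map_smul]
      filter_upwards [Lp.coeFn_sub (W (A (u k))) (s₀ • W (u k)), Lp.coeFn_smul s₀ (W (u k)),
        hA (u k), ih] with t h1 h2 h3 h4
      rw [h1, Pi.sub_apply, h2, Pi.smul_apply, h3, h4, smul_eq_mul]
      ring
  set f := W (u 0) with hf
  -- Where $|m-s_0|>q>r$ the $k$-th iterate is at least $q^k|f|$, so that part of $f$ has norm at
  -- most $(r/q)^k\|u_0\|\to0$. Countably many $q$ decreasing to $r$ exhaust $|m-s_0|>r$.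
  have hzero : ∀ n : ℕ, ∀ᵐ t ∂μ, r + 1 / (n + 1 : ℝ) < ‖m t - s₀‖ → f t = 0 := by
    intro n
    set q : ℝ := r + 1 / (n + 1 : ℝ) with hq
    have hrq : r < q := by rw [hq]; linarith [Nat.one_div_pos_of_nat (α := ℝ) (n := n)]
    have hq0 : 0 < q := hr.trans hrq
    set S : Set X := {t | q < ‖m t - s₀‖} with hS
    have hSm : MeasurableSet S := measurableSet_lt measurable_const (by fun_prop)
    have hle : ∀ k, ‖indicatorL2 μ hSm f‖ ≤ (r / q) ^ k * ‖(u 0 : H)‖ := by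
      intro k
      have h1 : ‖((q ^ k : ℝ) : ℂ) • indicatorL2 μ hSm f‖ ≤ ‖W (u k)‖ := by
        refine Lp.norm_le_norm_of_ae_le ?_
        filter_upwards [hpow k, Lp.coeFn_smul ((q ^ k : ℝ) : ℂ) (indicatorL2 μ hSm f),
          coeFn_indicatorL2 hSm f] with t h1 h2 h3
        rw [h2, h1, Pi.smul_apply, h3]
        by_cases ht : t ∈ S
        · rw [Set.indicator_of_mem ht, norm_smul, norm_mul, norm_pow, Complex.norm_real,
            Real.norm_of_nonneg (by positivity)]
          have : q < ‖m t - s₀‖ := ht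
          gcongr
        · rw [Set.indicator_of_notMem ht, smul_zero, norm_zero]
          positivity
      rw [norm_smul, Complex.norm_real, Real.norm_of_nonneg (by positivity), W.norm_map] at h1
      have h2 := h1.trans (hb k)
      rw [div_pow, div_mul_eq_mul_div, le_div_iff₀ (by positivity), mul_comm]
      exact h2
    have hlim : Tendsto (fun k : ℕ => (r / q) ^ k * ‖(u 0 : H)‖) atTop (𝓝 0) := by
      have := (tendsto_pow_atTop_nhds_zero_of_lt_one (div_pos hr hq0).le
        ((div_lt_one hq0).2 hrq)).mul_const ‖(u 0 : H)‖
      rwa [zero_mul] at this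
    have h0 : indicatorL2 μ hSm f = 0 :=
      norm_le_zero_iff.1 (ge_of_tendsto' hlim hle)
    filter_upwards [coeFn_indicatorL2 hSm f, Lp.coeFn_zero ℂ 2 μ] with t h1 h2 ht
    rw [h0, h2, Set.indicator_of_mem (show t ∈ S from ht)] at h1
    exact h1.symm
  apply W.injective
  rw [map_multiplicationResolution_proj W hm measurableSet_closedBall]
  refine Lp.ext ?_
  filter_upwards [coeFn_indicatorL2 (hm measurableSet_closedBall) f, ae_all_iff.2 hzero]
    with t h1 h2
  rw [h1]
  by_cases ht : t ∈ m ⁻¹' Metric.closedBall s₀ r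
  · rw [Set.indicator_of_mem ht]
  · rw [Set.indicator_of_notMem ht]
    have h3 : r < ‖m t - s₀‖ := by
      simpa [dist_eq_norm] using ht
    obtain ⟨n, hn⟩ := exists_nat_one_div_lt (sub_pos.2 h3)
    exact (h2 n (by linarith)).symm

end Multiplication

end

noncomputable section

/-! ### Locally absolutely continuous functions on the line -/

section AbsolutelyContinuous

theorem absolutelyContinuousOnInterval_integral {h : ℝ → ℂ} (hh : LocallyIntegrable h volume)
    (c a b : ℝ) : AbsolutelyContinuousOnInterval (fun x => ∫ t in c..x, h t) a b := by
  have hi : ∀ x y : ℝ, IntervalIntegrable h volume x y := fun x y =>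
    intervalIntegrable_iff.mpr
      ((hh.integrableOn_isCompact isCompact_uIcc).mono_set Set.uIoc_subset_uIcc)
  -- The interval is enlarged to contain the base point $c$ of the primitive.
  set p := min c (min a b)
  set q := max c (max a b)
  have hpq : p ≤ q := (min_le_left _ _).trans (le_max_left _ _)
  have hsub : Set.uIcc a b ⊆ Set.uIcc p q := by
    rw [Set.uIcc_of_le hpq]
    exact Set.Icc_subset_Icc (min_le_right _ _) (le_max_right _ _)
  have hc : c ∈ Set.uIcc p q := by
    rw [Set.uIcc_of_le hpq]
    exact ⟨min_le_left _ _, le_max_left _ _⟩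
  have hconst : ∀ z : ℂ, AbsolutelyContinuousOnInterval (fun _ : ℝ => z) p q := fun z =>
    (contDiff_const (c := z)).contDiffOn.absolutelyContinuousOnInterval
  have hre := (IntervalIntegrable.absolutelyContinuousOnInterval_intervalIntegral
    (f := fun t => (h t).re) ⟨(hi p q).1.re, (hi p q).2.re⟩ hc).smul (hconst 1)
  have him := (IntervalIntegrable.absolutelyContinuousOnInterval_intervalIntegral
    (f := fun t => (h t).im) ⟨(hi p q).1.im, (hi p q).2.im⟩ hc).smul (hconst Complex.I)
  refine AbsolutelyContinuousOnInterval.mono ?_ hsub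
  have heq : (fun x => ∫ t in c..x, h t) = ((fun x => ∫ t in c..x, (h t).re) • fun _ => (1 : ℂ)) +
      (fun x => ∫ t in c..x, (h t).im) • fun _ => Complex.I := by
    funext x
    have h1 : (∫ t in c..x, (h t).re) = (∫ t in c..x, h t).re :=
      Complex.reCLM.intervalIntegral_comp_comm (hi c x)
    have h2 : (∫ t in c..x, (h t).im) = (∫ t in c..x, h t).im :=
      Complex.imCLM.intervalIntegral_comp_comm (hi c x)
    simp only [Pi.add_apply, Pi.smul_apply', h1, h2, Complex.real_smul, mul_one]
    exact (Complex.re_add_im _).symm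
  rw [heq]
  exact hre.add him

/-- The fundamental theorem of calculus for locally absolutely continuous functions. -/
theorem integral_eq_sub_of_absolutelyContinuous {P q : ℝ → ℂ}
    (hP : ∀ a b, AbsolutelyContinuousOnInterval P a b) (hq : LocallyIntegrable q volume)
    (hd : ∀ᵐ t, HasDerivAt P (q t) t) (a b : ℝ) : ∫ t in a..b, q t = P b - P a := by
  obtain ⟨C, hC⟩ := ((hP a b).sub (absolutelyContinuousOnInterval_integral hq a a b))
    |>.const_of_ae_hasDerivAt_zero (by
      filter_upwards [hd, LocallyIntegrable.ae_hasDerivAt_integral hq] with t h1 h2 _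
      simpa using h1.sub (h2 a))
  have h1 := hC a Set.left_mem_uIcc
  have h2 := hC b Set.right_mem_uIcc
  simp only [Pi.sub_apply, intervalIntegral.integral_same, sub_zero] at h1 h2
  rw [h1, ← h2]; ring

/-- An integrable derivative gives $P$ limits at $\pm\infty$, and integrability of $P$ forces both
to vanish. -/
theorem integral_eq_zero_of_absolutelyContinuous {P q : ℝ → ℂ}
    (hP : ∀ a b, AbsolutelyContinuousOnInterval P a b) (hPi : Integrable P) (hq : Integrable q)
    (hd : ∀ᵐ t, HasDerivAt P (q t) t) : ∫ t, q t = 0 := by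
  have hftc := integral_eq_sub_of_absolutelyContinuous hP hq.locallyIntegrable hd
  have htop : Tendsto P atTop (𝓝 (P 0 + ∫ t in Set.Ioi 0, q t)) := by
    have := (intervalIntegral_tendsto_integral_Ioi 0 hq.integrableOn tendsto_id).const_add (P 0)
    refine this.congr fun x => ?_
    rw [hftc]; simp
  have hbot : Tendsto P atBot (𝓝 (P 0 - ∫ t in Set.Iic 0, q t)) := by
    have := (intervalIntegral_tendsto_integral_Iic 0 hq.integrableOn tendsto_id).const_sub (P 0)
    refine this.congr fun x => ?_
    rw [hftc]; simp
  have h1 : P 0 + ∫ t in Set.Ioi 0, q t = 0 := by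
    refine IntegrableAtFilter.eq_zero_of_tendsto (hPi.integrableAtFilter atTop) ?_ htop
    intro s hs
    obtain ⟨b, hb⟩ := mem_atTop_sets.1 hs
    exact measure_mono_top (fun x hx => hb x hx) (Real.volume_Ici (a := b))
  have h2 : P 0 - ∫ t in Set.Iic 0, q t = 0 := by
    refine IntegrableAtFilter.eq_zero_of_tendsto (hPi.integrableAtFilter atBot) ?_ hbot
    intro s hs
    obtain ⟨b, hb⟩ := mem_atBot_sets.1 hs
    exact measure_mono_top (fun x hx => hb x hx) (Real.volume_Iic (a := b))
  rw [← intervalIntegral.integral_Iic_add_Ioi hq.integrableOn hq.integrableOn (b := 0)]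
  linear_combination h1 - h2

end AbsolutelyContinuous

/-! ### Weak derivatives and the Fourier transform on $L^2$ -/

section WeakDerivative

open SchwartzMap FourierTransform
open scoped ContDiff

/-- `h` is the derivative of `g` in the sense of tempered distributions. -/
def IsWeakDeriv (g h : ℝ → ℂ) : Prop :=
  ∀ ψ : 𝓢(ℝ, ℂ), ∫ t, ψ t * h t = -∫ t, deriv ψ t * g t

theorem integrable_schwartz_mul (ψ : 𝓢(ℝ, ℂ)) {g : ℝ → ℂ} (hg : MemLp g 2 volume) :
    Integrable (fun t => ψ t * g t) :=
  (ψ.memLp 2 volume).integrable_mul hg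

/-- Integration by parts: $\psi G$ and its derivative are integrable as sums of products of $L^2$
functions, so there are no boundary terms. -/
theorem isWeakDeriv_of_absolutelyContinuous {g h G : ℝ → ℂ} (hg : MemLp g 2 volume)
    (hh : MemLp h 2 volume) (hgG : g =ᵐ[volume] G)
    (hG : ∀ a b, AbsolutelyContinuousOnInterval G a b)
    (hd : ∀ᵐ t, HasDerivAt G (h t) t) : IsWeakDeriv g h := by
  intro ψ
  have hψ := ψ.hasDerivAt
  have hGL : MemLp G 2 volume := (memLp_congr_ae hgG).1 hg
  have i1 : Integrable fun t => deriv ψ t * G t :=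
    integrable_schwartz_mul (SchwartzMap.derivCLM ℂ ℂ ψ) hGL
  have i2 := integrable_schwartz_mul ψ hh
  have h0 := integral_eq_zero_of_absolutelyContinuous (P := fun t => ψ t * G t)
    (q := fun t => deriv ψ t * G t + ψ t * h t)
    (fun a b => ((ψ.smooth 1).contDiffOn.absolutelyContinuousOnInterval).smul (hG a b))
    (integrable_schwartz_mul ψ hGL) (i1.add i2)
    (by filter_upwards [hd] with t ht using (hψ t).mul ht)
  rw [integral_add i1 i2] at h0
  have h1 : ∫ t, deriv ψ t * g t = ∫ t, deriv ψ t * G t :=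
    integral_congr_ae (by filter_upwards [hgG] with t ht; rw [ht])
  rw [h1]
  linear_combination h0

/-- A test function of mean zero is the derivative of a test function. -/
theorem exists_hasCompactSupport_primitive {p : ℝ → ℝ} (hp : ContDiff ℝ ∞ p)
    (hs : HasCompactSupport p) (h0 : ∫ t, p t = 0) :
    ∃ φ : ℝ → ℝ, ContDiff ℝ ∞ φ ∧ HasCompactSupport φ ∧ ∀ t, HasDerivAt φ (p t) t := by
  obtain ⟨r, hr⟩ := hs.isBounded.subset_closedBall 0
  -- The extra 1 keeps the support away from the excluded left endpoint of the half-open interval.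
  set R := r + 1 with hR
  have hz : ∀ t, t ∉ Set.Ioc (-R) R → p t = 0 := fun t ht =>
    image_eq_zero_of_notMem_tsupport fun h => ht (by
      have := hr h
      rw [Real.closedBall_eq_Icc, zero_sub, zero_add] at this
      exact ⟨by linarith [this.1], by linarith [this.2]⟩)
  have hd : ∀ t, HasDerivAt (fun x => ∫ s in (-R)..x, p s) (p t) t := fun t =>
    intervalIntegral.integral_hasDerivAt_right (hp.continuous.intervalIntegrable _ _)
      (hp.continuous.stronglyMeasurableAtFilter _ _) hp.continuous.continuousAt
  refine ⟨fun x => ∫ s in (-R)..x, p s, ?_, ?_, hd⟩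
  · rw [contDiff_infty_iff_deriv]
    refine ⟨fun t => (hd t).differentiableAt, ?_⟩
    rwa [show deriv (fun x => ∫ s in (-R)..x, p s) = p from funext fun t => (hd t).deriv]
  · refine HasCompactSupport.intro (isCompact_Icc (a := -R) (b := R)) fun x hx => ?_
    rw [Set.mem_Icc, not_and_or, not_le, not_le] at hx
    rcases hx with hx | hx
    · rw [intervalIntegral.integral_symm, neg_eq_zero]
      refine intervalIntegral.integral_zero_ae (Eventually.of_forall fun t ht => ?_)
      rw [Set.uIoc_of_le hx.le] at ht
      exact hz t fun h => (h.1.trans_le ht.2).false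
    · rw [← h0]
      refine intervalIntegral.integral_eq_integral_of_support_subset fun t ht => ?_
      by_contra hn
      exact ht (hz t fun h => hn ⟨h.1, h.2.trans hx.le⟩)

/-- The du Bois-Reymond lemma: $g$ minus a primitive of $h$ annihilates derivatives of test
functions, that is, all test functions of mean zero, so it is constant. -/
theorem exists_absolutelyContinuous_of_isWeakDeriv {g h : ℝ → ℂ} (hg : MemLp g 2 volume)
    (hh : MemLp h 2 volume) (hw : IsWeakDeriv g h) :
    ∃ G : ℝ → ℂ, g =ᵐ[volume] G ∧ (∀ a b, AbsolutelyContinuousOnInterval G a b) ∧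
      ∀ᵐ t, HasDerivAt G (h t) t := by
  have hhl : LocallyIntegrable h volume := hh.locallyIntegrable (by norm_num)
  set G₀ : ℝ → ℂ := fun x => ∫ t in (0 : ℝ)..x, h t with hG₀
  have hac : ∀ a b, AbsolutelyContinuousOnInterval G₀ a b := fun a b =>
    absolutelyContinuousOnInterval_integral hhl 0 a b
  have hder : ∀ᵐ t, HasDerivAt G₀ (h t) t := by
    filter_upwards [LocallyIntegrable.ae_hasDerivAt_integral hhl] with t ht using ht 0
  have hcont : Continuous G₀ := continuous_iff_continuousAt.2 fun t =>
    (hac (t - 1) (t + 1)).continuousOn.continuousAt (by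
      rw [Set.uIcc_of_le (by linarith)]
      exact Icc_mem_nhds (by linarith) (by linarith))
  have hloc : LocallyIntegrable (fun t => g t - G₀ t) volume :=
    (hg.locallyIntegrable (by norm_num)).sub hcont.locallyIntegrable
  have hint : ∀ φ : ℝ → ℝ, Continuous φ → HasCompactSupport φ →
      Integrable fun t => (φ t : ℂ) * (g t - G₀ t) := fun φ hφ hφc => by
    simpa using hloc.integrable_smul_left_of_hasCompactSupport hφ hφc
  have hzero : ∀ p : ℝ → ℝ, ContDiff ℝ ∞ p → HasCompactSupport p → ∫ t, p t = 0 →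
      ∫ t, (p t : ℂ) * (g t - G₀ t) = 0 := by
    intro p hp hpc hp0
    obtain ⟨φ, hφ, hφc, hφd⟩ := exists_hasCompactSupport_primitive hp hpc hp0
    have hc₁ : HasCompactSupport (Complex.ofRealCLM ∘ φ) := hφc.comp_left rfl
    have hc₂ : ContDiff ℝ ∞ (Complex.ofRealCLM ∘ φ) := by fun_prop
    have hφd' : ∀ t, HasDerivAt (Complex.ofRealCLM ∘ φ) (p t : ℂ) t := fun t =>
      (hφd t).ofReal_comp
    have h1 := hw (hc₁.toSchwartzMap hc₂)
    have h2 : ∀ t, deriv (hc₁.toSchwartzMap hc₂) t = (p t : ℂ) := fun t => (hφd' t).deriv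
    simp only [h2] at h1
    have i0 : Integrable fun t => (φ t : ℂ) * G₀ t :=
      Continuous.integrable_of_hasCompactSupport (by fun_prop) hc₁.mul_right
    have i1 : Integrable fun t => (p t : ℂ) * G₀ t :=
      Continuous.integrable_of_hasCompactSupport
        ((Complex.continuous_ofReal.comp hp.continuous).mul hcont)
        ((hpc.comp_left (g := Complex.ofReal) rfl).mul_right)
    have i2 : Integrable fun t => (φ t : ℂ) * h t :=
      integrable_schwartz_mul (hc₁.toSchwartzMap hc₂) hh
    have h3 := integral_eq_zero_of_absolutelyContinuous (P := fun t => (φ t : ℂ) * G₀ t)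
      (q := fun t => (p t : ℂ) * G₀ t + (φ t : ℂ) * h t)
      (fun a b => ((hc₂.of_le (by simp)).contDiffOn.absolutelyContinuousOnInterval).smul (hac a b))
      i0 (i1.add i2) (by filter_upwards [hder] with t ht using (hφd' t).mul ht)
    rw [integral_add i1 i2] at h3
    have i3 : Integrable fun t => (p t : ℂ) * g t := by
      have := (hint p hp.continuous hpc).add i1
      refine this.congr (Eventually.of_forall fun t => ?_)
      simp only [Pi.add_apply]; ring
    simp only [mul_sub]
    rw [integral_sub i3 i1]
    have h4 : ∫ t, (hc₁.toSchwartzMap hc₂) t * h t = ∫ t, (φ t : ℂ) * h t := rfl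
    rw [h4] at h1
    linear_combination h1 - h3
  -- Subtracting $(\int\psi)\eta$, with $\eta$ of integral one, makes any test function $\psi$
  -- mean-zero; the constant is therefore the pairing with $\eta$.
  let η : ContDiffBump (0 : ℝ) := default
  have hηs : ContDiff ℝ ∞ (η.normed volume) := η.contDiff_normed
  have hηc : HasCompactSupport (η.normed volume) := η.hasCompactSupport_normed
  set C : ℂ := ∫ t, (η.normed volume t : ℂ) * (g t - G₀ t) with hC
  have hconst : ∀ᵐ t, g t - G₀ t = C := by
    refine ae_eq_of_integral_contDiff_smul_eq hloc (locallyIntegrable_const C) ?_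
    intro ψ hψ hψc
    have hψi : Integrable ψ := hψ.continuous.integrable_of_hasCompactSupport hψc
    have hηi : Integrable (η.normed volume) := η.integrable_normed
    have h1 := hzero (fun t => ψ t - (∫ s, ψ s) * η.normed volume t) (by fun_prop)
      (hψc.sub hηc.mul_left)
      (by rw [integral_sub hψi (hηi.const_mul _), integral_const_mul, η.integral_normed]; ring)
    have h2 : ∀ t, ((ψ t - (∫ s, ψ s) * η.normed volume t : ℝ) : ℂ) * (g t - G₀ t) =
        (ψ t : ℂ) * (g t - G₀ t) -
          ((∫ s, ψ s : ℝ) : ℂ) * ((η.normed volume t : ℂ) * (g t - G₀ t)) := by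
      intro t; push_cast; ring
    simp only [h2] at h1
    rw [integral_sub (hint ψ hψ.continuous hψc)
      ((hint _ hηs.continuous hηc).const_mul _), integral_const_mul, ← hC] at h1
    simp only [Complex.real_smul]
    rw [integral_mul_const, integral_complex_ofReal]
    linear_combination h1
  refine ⟨fun t => G₀ t + C, ?_, fun a b => (hac a b).add
    (contDiff_const (c := C)).contDiffOn.absolutelyContinuousOnInterval, ?_⟩
  · filter_upwards [hconst] with t ht
    rw [← ht]; ring
  · filter_upwards [hder] with t ht using ht.add_const C

/-- The Fourier transform on `L²` can be moved to a Schwartz function. -/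
theorem integral_mul_fourier (f : Lp ℂ 2 (volume : Measure ℝ)) (φ : 𝓢(ℝ, ℂ)) :
    ∫ ξ, φ ξ * (𝓕 f : Lp ℂ 2 (volume : Measure ℝ)) ξ = ∫ t, (𝓕 φ : 𝓢(ℝ, ℂ)) t * f t := by
  have := congrArg (fun T => T φ) (Lp.fourier_toTemperedDistribution_eq f)
  simpa using this.symm

/-- Both sides are tested on Schwartz functions, where $(\mathcal F\varphi)'=\mathcal F(-2\pi
i\xi\varphi)$. Compactly supported $\varphi$ suffice to identify $\mathcal F h$; conversely every
Schwartz function is some $\mathcal F\varphi$. -/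
theorem isWeakDeriv_iff_fourier (g h : Lp ℂ 2 (volume : Measure ℝ)) :
    IsWeakDeriv g h ↔
      (𝓕 h : Lp ℂ 2 (volume : Measure ℝ)) =ᵐ[volume]
        fun ξ : ℝ => 2 * Real.pi * Complex.I * ξ * (𝓕 g : Lp ℂ 2 (volume : Measure ℝ)) ξ := by
  have htg : Function.HasTemperateGrowth (fun x : ℝ => inner ℝ x (1 : ℝ)) := by fun_prop
  have e2 : ∀ φ : 𝓢(ℝ, ℂ),
      ∫ ξ : ℝ, φ ξ * (2 * Real.pi * Complex.I * ξ * (𝓕 g : Lp ℂ 2 (volume : Measure ℝ)) ξ) =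
        -∫ t, deriv (𝓕 φ : 𝓢(ℝ, ℂ)) t * g t := by
    intro φ
    have h1 := integral_mul_fourier g ((-(2 * Real.pi * Complex.I)) • smulLeftCLM ℂ (fun x : ℝ => inner ℝ x (1 : ℝ)) φ)
    rw [← SchwartzMap.lineDerivOp_fourier_eq] at h1
    have h2 : ∀ t, (LineDeriv.lineDerivOp (1 : ℝ) (𝓕 φ : 𝓢(ℝ, ℂ))) t = deriv (𝓕 φ : 𝓢(ℝ, ℂ)) t := by
      intro t
      rw [SchwartzMap.lineDerivOp_apply_eq_fderiv]
      rfl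
    simp only [h2] at h1
    rw [← h1, ← integral_neg]
    congr 1
    ext ξ
    rw [_root_.smul_apply, smulLeftCLM_apply_apply htg]
    simp
    ring
  constructor
  · intro hw
    have hloc : LocallyIntegrable (fun ξ : ℝ =>
        2 * Real.pi * Complex.I * ξ * (𝓕 g : Lp ℂ 2 (volume : Measure ℝ)) ξ) volume :=
      ((Lp.memLp (𝓕 g : Lp ℂ 2 (volume : Measure ℝ))).locallyIntegrable
        (by norm_num)).continuous_smul (g := fun ξ : ℝ => 2 * Real.pi * Complex.I * ξ) (by fun_prop)
    refine ae_eq_of_integral_contDiff_smul_eq ((Lp.memLp _).locallyIntegrable (by norm_num)) hloc ?_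
    intro φ hφ hφc
    have hg₁ : HasCompactSupport (Complex.ofRealCLM ∘ φ) := hφc.comp_left rfl
    have hg₂ : ContDiff ℝ ∞ (Complex.ofRealCLM ∘ φ) := by fun_prop
    have := hw (𝓕 (hg₁.toSchwartzMap hg₂))
    rw [← integral_mul_fourier, ← e2] at this
    simpa using this
  · intro hae ψ
    obtain ⟨φ, rfl⟩ : ∃ φ : 𝓢(ℝ, ℂ), 𝓕 φ = ψ := ⟨𝓕⁻ ψ, fourier_fourierInv_eq ψ⟩
    rw [← integral_mul_fourier, ← e2]
    refine integral_congr_ae ?_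
    filter_upwards [hae] with t ht
    rw [ht]

end WeakDerivative

end

noncomputable section

/-! ### Translations under the Fourier transform -/

section Translation

open SchwartzMap FourierTransform
open scoped ContDiff

/-- Translation by `a`, as an isometry of `L²(ℝ)`. -/
def translateL2 (a : ℝ) : Lp ℂ 2 (volume : Measure ℝ) →ₗᵢ[ℂ] Lp ℂ 2 (volume : Measure ℝ) :=
  Lp.compMeasurePreservingₗᵢ ℂ (fun t => t - a) (measurePreserving_sub_right volume a)

theorem coeFn_translateL2 (a : ℝ) (f : Lp ℂ 2 (volume : Measure ℝ)) :
    translateL2 a f =ᵐ[volume] fun t => f (t - a) :=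
  Lp.coeFn_compMeasurePreserving f (measurePreserving_sub_right volume a)

theorem fourier_translateL2 (a : ℝ) (f : Lp ℂ 2 (volume : Measure ℝ)) :
    (𝓕 (translateL2 a f) : Lp ℂ 2 (volume : Measure ℝ)) =ᵐ[volume]
      fun ξ : ℝ => Complex.exp (-(2 * Real.pi * Complex.I * a * ξ)) *
        (𝓕 f : Lp ℂ 2 (volume : Measure ℝ)) ξ := by
  refine ae_eq_of_integral_contDiff_smul_eq ((Lp.memLp _).locallyIntegrable (by norm_num))
    (((Lp.memLp (𝓕 f : Lp ℂ 2 (volume : Measure ℝ))).locallyIntegrable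
        (by norm_num)).continuous_smul
      (g := fun ξ : ℝ => Complex.exp (-(2 * Real.pi * Complex.I * a * ξ))) (by fun_prop)) ?_
  intro φ hφ hφc
  have hc₁ : HasCompactSupport (Complex.ofRealCLM ∘ φ) := hφc.comp_left rfl
  have hc₂ : ContDiff ℝ ∞ (Complex.ofRealCLM ∘ φ) := by fun_prop
  have hofReal : ContDiff ℝ ∞ (fun ξ : ℝ => (ξ : ℂ)) := Complex.ofRealCLM.contDiff
  have hexp : ContDiff ℝ ∞ (fun ξ : ℝ => Complex.exp (-(2 * Real.pi * Complex.I * a * ξ))) :=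
    (contDiff_const.mul hofReal).neg.cexp
  have hd₁ : HasCompactSupport (fun ξ : ℝ =>
      Complex.exp (-(2 * Real.pi * Complex.I * a * ξ)) * (Complex.ofRealCLM ∘ φ) ξ) := hc₁.mul_left
  have hd₂ : ContDiff ℝ ∞ (fun ξ : ℝ =>
      Complex.exp (-(2 * Real.pi * Complex.I * a * ξ)) * (Complex.ofRealCLM ∘ φ) ξ) :=
    hexp.mul hc₂
  -- The integral formula for $\mathcal F$ is available on test functions, so the modulation is
  -- moved onto $\varphi$, where it becomes a shift by $a$.
  have hF : ∀ t : ℝ, (𝓕 (hd₁.toSchwartzMap hd₂) : 𝓢(ℝ, ℂ)) t =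
      (𝓕 (hc₁.toSchwartzMap hc₂) : 𝓢(ℝ, ℂ)) (t + a) := by
    intro t
    rw [SchwartzMap.fourier_coe, SchwartzMap.fourier_coe, Real.fourier_real_eq_integral_exp_smul,
      Real.fourier_real_eq_integral_exp_smul]
    refine integral_congr_ae (Eventually.of_forall fun ξ => ?_)
    simp only [HasCompactSupport.toSchwartzMap_toFun, smul_eq_mul]
    rw [← mul_assoc, ← Complex.exp_add]
    congr 2
    push_cast
    ring
  have h1 := integral_mul_fourier (translateL2 a f) (hc₁.toSchwartzMap hc₂)
  have h2 := integral_mul_fourier f (hd₁.toSchwartzMap hd₂)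
  have h3 : ∫ t, (𝓕 (hc₁.toSchwartzMap hc₂) : 𝓢(ℝ, ℂ)) t * translateL2 a f t =
      ∫ t, (𝓕 (hd₁.toSchwartzMap hd₂) : 𝓢(ℝ, ℂ)) t * f t := by
    rw [← integral_sub_right_eq_self (fun t => (𝓕 (hd₁.toSchwartzMap hd₂) : 𝓢(ℝ, ℂ)) t * f t) a]
    refine integral_congr_ae ?_
    filter_upwards [coeFn_translateL2 a f] with t ht
    rw [ht, hF, sub_add_cancel]
  rw [h3, ← h2] at h1
  have h4 : ∀ ξ : ℝ, φ ξ • (Complex.exp (-(2 * Real.pi * Complex.I * a * ξ)) *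
      (𝓕 f : Lp ℂ 2 (volume : Measure ℝ)) ξ) = (hd₁.toSchwartzMap hd₂) ξ *
      (𝓕 f : Lp ℂ 2 (volume : Measure ℝ)) ξ := by
    intro ξ
    simp only [HasCompactSupport.toSchwartzMap_toFun, Complex.real_smul, Function.comp_apply,
      Complex.ofRealCLM_apply]
    ring
  simp only [h4]
  rw [← h1]
  rfl

end Translation

/-! ### Diagonalization of the infinitesimal shift -/

section Weighted

variable {c : ℝ}

/-- The density is strictly positive, so almost-everywhere statements pass freely between the two
measures. -/
theorem ae_weightMeasure (c : ℝ) : ae (weightMeasure c) = ae volume :=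
  le_antisymm (withDensity_absolutelyContinuous _ _).ae_le
    (withDensity_absolutelyContinuous' (by fun_prop)
      (Eventually.of_forall fun t => by simp [Real.exp_pos])).ae_le

theorem aestronglyMeasurable_weightMeasure_iff {f : ℝ → ℂ} :
    AEStronglyMeasurable f (weightMeasure c) ↔ AEStronglyMeasurable f volume := by
  have h := ae_weightMeasure c
  exact ⟨fun hf => hf.mono_ac (Measure.ae_le_iff_absolutelyContinuous.1 h.ge),
    fun hf => hf.mono_ac (Measure.ae_le_iff_absolutelyContinuous.1 h.le)⟩

theorem eLpNorm_weightMeasure (f : ℝ → ℂ) :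
    eLpNorm f 2 (weightMeasure c) = eLpNorm (fun t : ℝ => Complex.exp (-(c * t)) * f t) 2 volume := by
  rw [eLpNorm_eq_lintegral_rpow_enorm_toReal (by norm_num) (by norm_num),
    eLpNorm_eq_lintegral_rpow_enorm_toReal (by norm_num) (by norm_num), weightMeasure,
    lintegral_withDensity_eq_lintegral_mul_non_measurable _ (by fun_prop)
      (Eventually.of_forall fun t => ENNReal.ofReal_lt_top)]
  congr 1
  refine lintegral_congr fun t => ?_
  simp only [Pi.mul_apply, ENNReal.toReal_ofNat, ENNReal.rpow_ofNat, enorm_mul, mul_pow]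
  congr 1
  rw [← ofReal_norm, Complex.norm_exp, ← ENNReal.ofReal_pow (Real.exp_pos _).le, ← Real.exp_nat_mul]
  congr 2
  simp
  ring

theorem memLp_weightMeasure_iff {f : ℝ → ℂ} :
    MemLp f 2 (weightMeasure c) ↔ MemLp (fun t : ℝ => Complex.exp (-(c * t)) * f t) 2 volume := by
  rw [MemLp, MemLp, eLpNorm_weightMeasure, aestronglyMeasurable_weightMeasure_iff]
  refine and_congr_left fun _ => ⟨fun h => ?_, fun h => ?_⟩
  · exact AEStronglyMeasurable.mul (by fun_prop) h
  · have : AEStronglyMeasurable (fun t : ℝ => Complex.exp (c * t) *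
        (Complex.exp (-(c * t)) * f t)) volume := AEStronglyMeasurable.mul (by fun_prop) h
    refine this.congr (Eventually.of_forall fun t => ?_)
    simp only
    rw [← mul_assoc, ← Complex.exp_add]; simp

/-- The isometry `f ↦ e^{-ct} f` from `ℍ_c` to `L²(ℝ)`. -/
def weightIsometry (c : ℝ) : WeightedL2 c →ₗᵢ[ℂ] Lp ℂ 2 (volume : Measure ℝ) where
  toFun f := (memLp_weightMeasure_iff.1 (Lp.memLp f)).toLp _
  map_add' f g := by
    refine Lp.ext ((MemLp.coeFn_toLp _).trans ?_)
    have hadd := Lp.coeFn_add f g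
    rw [EventuallyEq, ae_weightMeasure] at hadd
    filter_upwards [hadd, Lp.coeFn_add ((memLp_weightMeasure_iff.1 (Lp.memLp f)).toLp _)
      ((memLp_weightMeasure_iff.1 (Lp.memLp g)).toLp _),
      (memLp_weightMeasure_iff.1 (Lp.memLp f)).coeFn_toLp,
      (memLp_weightMeasure_iff.1 (Lp.memLp g)).coeFn_toLp] with t h1 h2 h3 h4
    rw [h2, Pi.add_apply, h3, h4, h1, Pi.add_apply, mul_add]
  map_smul' a f := by
    refine Lp.ext ((MemLp.coeFn_toLp _).trans ?_)
    have hsmul := Lp.coeFn_smul a f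
    rw [EventuallyEq, ae_weightMeasure] at hsmul
    filter_upwards [hsmul, Lp.coeFn_smul a ((memLp_weightMeasure_iff.1 (Lp.memLp f)).toLp _),
      (memLp_weightMeasure_iff.1 (Lp.memLp f)).coeFn_toLp] with t h1 h2 h3
    rw [RingHom.id_apply, h2, Pi.smul_apply, h3, h1, Pi.smul_apply, mul_smul_comm]
  norm_map' f := by
    simp only [LinearMap.coe_mk, AddHom.coe_mk]
    rw [Lp.norm_toLp, ← eLpNorm_weightMeasure, Lp.norm_def]

theorem coeFn_weightIsometry (f : WeightedL2 c) :
    weightIsometry c f =ᵐ[volume] fun t => Complex.exp (-(c * t)) * f t :=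
  (memLp_weightMeasure_iff.1 (Lp.memLp f)).coeFn_toLp

theorem weightIsometry_surjective (c : ℝ) : Function.Surjective (weightIsometry c) := by
  intro g
  have he : (fun t : ℝ => Complex.exp (-(c * t)) * (Complex.exp (c * t) * g t)) = g := by
    funext t
    rw [← mul_assoc, ← Complex.exp_add]; simp
  have hm : MemLp (fun t : ℝ => Complex.exp (c * t) * g t) 2 (weightMeasure c) := by
    rw [memLp_weightMeasure_iff, he]; exact Lp.memLp g
  refine ⟨hm.toLp _, Lp.ext ?_⟩
  have h1 := hm.coeFn_toLp
  rw [EventuallyEq, ae_weightMeasure] at h1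
  filter_upwards [coeFn_weightIsometry (hm.toLp _), h1] with t h2 h3
  rw [h2, h3]
  exact congrFun he t

/-- The unitary `f ↦ e^{-ct} f` from `ℍ_c` onto `L²(ℝ)`. -/
def weightEquiv (c : ℝ) : WeightedL2 c ≃ₗᵢ[ℂ] Lp ℂ 2 (volume : Measure ℝ) :=
  LinearIsometryEquiv.ofSurjective (weightIsometry c) (weightIsometry_surjective c)

theorem coeFn_weightEquiv (f : WeightedL2 c) :
    weightEquiv c f =ᵐ[volume] fun t => Complex.exp (-(c * t)) * f t :=
  coeFn_weightIsometry f

/-- The unitary `f ↦ 𝓕 (e^{-ct} f)` which diagonalizes the infinitesimal shift. -/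
def fourierWeightEquiv (c : ℝ) : WeightedL2 c ≃ₗᵢ[ℂ] Lp ℂ 2 (volume : Measure ℝ) :=
  (weightEquiv c).trans (Lp.fourierTransformₗᵢ ℝ ℂ)

/-- The symbol `ξ ↦ c + 2πiξ` of the infinitesimal shift. -/
def shiftSymbol (c ξ : ℝ) : ℂ := c + 2 * Real.pi * Complex.I * ξ

theorem measurable_shiftSymbol (c : ℝ) : Measurable (shiftSymbol c) := by
  unfold shiftSymbol; fun_prop

theorem shiftSymbol_re (c ξ : ℝ) : (shiftSymbol c ξ).re = c := by simp [shiftSymbol]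

open FourierTransform in
-- Since $(e^{-ct}f)'=e^{-ct}(f'-cf)$, the weight turns $\partial_c$ into $d/dt+c$, which accounts
-- for the real part $c$ of the symbol.
theorem isWeakDeriv_weightEquiv_iff (f g : WeightedL2 c) :
    IsWeakDeriv (weightEquiv c f) (weightEquiv c g - (c : ℂ) • weightEquiv c f : Lp ℂ 2 volume) ↔
      fourierWeightEquiv c g =ᵐ[volume] fun ξ => shiftSymbol c ξ * fourierWeightEquiv c f ξ := by
  rw [isWeakDeriv_iff_fourier]
  have h : (𝓕 (weightEquiv c g - (c : ℂ) • weightEquiv c f) : Lp ℂ 2 (volume : Measure ℝ)) =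
      fourierWeightEquiv c g - (c : ℂ) • fourierWeightEquiv c f := by
    change Lp.fourierTransformₗᵢ ℝ ℂ _ = _
    rw [map_sub, map_smul]
    rfl
  rw [h]
  have h' : (𝓕 (weightEquiv c f) : Lp ℂ 2 (volume : Measure ℝ)) = fourierWeightEquiv c f := rfl
  rw [h']
  have h1 := Lp.coeFn_sub (fourierWeightEquiv c g) ((c : ℂ) • fourierWeightEquiv c f)
  have h2 := Lp.coeFn_smul (c : ℂ) (fourierWeightEquiv c f)
  constructor
  · intro h3
    filter_upwards [h1, h2, h3] with t h1 h2 h3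
    rw [h1, Pi.sub_apply, h2, Pi.smul_apply, smul_eq_mul] at h3
    rw [shiftSymbol]
    linear_combination h3
  · intro h3
    filter_upwards [h1, h2, h3] with t h1 h2 h3
    rw [h1, Pi.sub_apply, h2, Pi.smul_apply, smul_eq_mul, h3, shiftSymbol]
    ring

theorem hasDerivAt_cexp_mul (a : ℂ) (t : ℝ) :
    HasDerivAt (fun t : ℝ => Complex.exp (a * t)) (a * Complex.exp (a * t)) t := by
  have h := ((hasDerivAt_id (t : ℂ)).const_mul a).cexp.comp_ofReal
  simpa [mul_comm] using h

theorem absolutelyContinuousOnInterval_cexp_mul (a : ℂ) (x y : ℝ) :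
    AbsolutelyContinuousOnInterval (fun t : ℝ => Complex.exp (a * t)) x y := by
  have h : ContDiff ℝ 1 (fun t : ℝ => (t : ℂ)) := Complex.ofRealCLM.contDiff
  exact (contDiff_const.mul h).cexp.contDiffOn.absolutelyContinuousOnInterval

theorem mem_shiftGraph_iff (p : WeightedL2 c × WeightedL2 c) :
    p ∈ shiftGraph c ↔
      fourierWeightEquiv c p.2 =ᵐ[volume]
        fun ξ => shiftSymbol c ξ * fourierWeightEquiv c p.1 ξ := by
  rw [← isWeakDeriv_weightEquiv_iff]
  have hf := coeFn_weightEquiv p.1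
  have hg := coeFn_weightEquiv p.2
  have hsub := Lp.coeFn_sub (weightEquiv c p.2) ((c : ℂ) • weightEquiv c p.1)
  have hsmul := Lp.coeFn_smul (c : ℂ) (weightEquiv c p.1)
  have hexp : ∀ t : ℝ, Complex.exp (c * t) * Complex.exp (-c * t) = 1 := fun t => by
    rw [← Complex.exp_add]; simp
  constructor
  · rintro ⟨F, hF, hFa, hFd⟩
    rw [EventuallyEq, ae_weightMeasure] at hF
    rw [ae_weightMeasure] at hFd
    refine isWeakDeriv_of_absolutelyContinuous (G := fun t => Complex.exp (-c * t) * F t)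
      (Lp.memLp _) (Lp.memLp _) ?_
      (fun a b => (absolutelyContinuousOnInterval_cexp_mul (-c) a b).smul (hFa a b)) ?_
    · filter_upwards [hf, hF] with t h1 h2
      rw [h1, h2, neg_mul]
    · filter_upwards [hf, hg, hF, hFd, hsub, hsmul] with t h1 h2 h3 h4 h5 h6
      rw [h5, Pi.sub_apply, h6, Pi.smul_apply, h1, h2, h3, smul_eq_mul]
      refine ((hasDerivAt_cexp_mul (-c) t).mul h4).congr_deriv ?_
      simp only [neg_mul]
      ring
  · intro hw
    obtain ⟨G, hG, hGa, hGd⟩ :=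
      exists_absolutelyContinuous_of_isWeakDeriv (Lp.memLp _) (Lp.memLp _) hw
    refine ⟨fun t => Complex.exp (c * t) * G t, ?_,
      fun a b => (absolutelyContinuousOnInterval_cexp_mul c a b).smul (hGa a b), ?_⟩
    · rw [EventuallyEq, ae_weightMeasure]
      filter_upwards [hf, hG] with t h1 h2
      rw [← h2, h1, ← mul_assoc, ← neg_mul, hexp, one_mul]
    · rw [ae_weightMeasure]
      filter_upwards [hf, hg, hG, hGd, hsub, hsmul] with t h1 h2 h3 h4 h5 h6
      rw [h5, Pi.sub_apply, h6, Pi.smul_apply, h3, h2, smul_eq_mul] at h4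
      refine ((hasDerivAt_cexp_mul c t).mul h4).congr_deriv ?_
      rw [← neg_mul]
      linear_combination (p.2 t) * hexp t

end Weighted

end

noncomputable section

variable {c : ℝ}

/-! ### The spectral measure of the infinitesimal shift -/

theorem mem_graph_infinitesimalShift_iff (f g : WeightedL2 c) :
    (f, g) ∈ (infinitesimalShift c).graph ↔ fourierWeightEquiv c g =ᵐ[volume]
      fun ξ => shiftSymbol c ξ * fourierWeightEquiv c f ξ := by
  rw [infinitesimalShift, Submodule.toLinearPMap_graph_eq _
    (fun p hp h0 => shiftGraph_singleValued c p hp h0), mem_shiftGraph_iff]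

theorem fourierWeightEquiv_infinitesimalShift (f : (infinitesimalShift c).domain) :
    fourierWeightEquiv c (infinitesimalShift c f) =ᵐ[volume]
      fun ξ => shiftSymbol c ξ * fourierWeightEquiv c f ξ :=
  (mem_graph_infinitesimalShift_iff _ _).1 (LinearPMap.mem_graph _ f)

/-- The spectral measure of the infinitesimal shift. -/
def shiftResolution (c : ℝ) : ResolutionOfIdentity ℂ (WeightedL2 c) :=
  multiplicationResolution (fourierWeightEquiv c) (measurable_shiftSymbol c)

theorem shiftResolution_isSpectralIntegral (c : ℝ) :
    (shiftResolution c).IsSpectralIntegral (fun s => s) (infinitesimalShift c) := by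
  refine multiplicationResolution_isSpectralIntegral _ _ measurable_id (fun f hf => ?_)
    fourierWeightEquiv_infinitesimalShift
  -- If the symbol times $Wf$ is in $L^2$, its preimage under $W$ is the derivative of $f$, because
  -- the graph criterion is an equivalence.
  refine LinearPMap.mem_domain_of_mem_graph
    (y := (fourierWeightEquiv c).symm (hf.toLp _)) ((mem_graph_infinitesimalShift_iff _ _).2 ?_)
  rw [LinearIsometryEquiv.apply_symm_apply]
  exact hf.coeFn_toLp

theorem scalarMeasure_eq_shiftResolution (E : ResolutionOfIdentity ℂ (WeightedL2 c))
    (hE : E.IsSpectralIntegral (fun s => s) (infinitesimalShift c)) (f : WeightedL2 c) :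
    E.scalarMeasure f = (shiftResolution c).scalarMeasure f :=
  ResolutionOfIdentity.scalarMeasure_eq_of_isSpectralIntegral hE
    (fun _ _ hr _ hu hb => multiplicationResolution_proj_closedBall _ _
      fourierWeightEquiv_infinitesimalShift hr hu hb) f

theorem functionOfOperator_infinitesimalShift {φ : ℂ → ℂ} {T : WeightedL2 c →L[ℂ] WeightedL2 c}
    (hT : (shiftResolution c).IsSpectralIntegral φ (boundedAsPartial T)) :
    functionOfOperator (infinitesimalShift c) φ = boundedAsPartial T :=
  functionOfOperator_eq_boundedAsPartial (shiftResolution_isSpectralIntegral c)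
    scalarMeasure_eq_shiftResolution hT

/-- The values of the symbol lie on a vertical line; for $c>1$ it is inside the half-plane of
absolute convergence of the Dirichlet series. -/
theorem ae_re_eq (f : WeightedL2 c) :
    ∀ᵐ s ∂((shiftResolution c).scalarMeasure f), s.re = c := by
  rw [shiftResolution, multiplicationResolution_scalarMeasure,
    ae_map_iff (measurable_shiftSymbol c).aemeasurable
      (measurableSet_eq_fun Complex.measurable_re measurable_const)]
  exact Eventually.of_forall fun ξ => shiftSymbol_re c ξ

/-- Bounded operators that agree on the domain of the infinitesimal shift are equal. -/
theorem eq_of_eqOn_domain {S T : WeightedL2 c →L[ℂ] WeightedL2 c}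
    (h : ∀ f ∈ (infinitesimalShift c).domain, S f = T f) : S = T := by
  ext1 f
  -- Density of the domain: $f$ is the sum of its spectral components over bounded annuli, each of
  -- which lies in the domain.
  have hs := (shiftResolution c).hasSum_proj_fiber
    ResolutionOfIdentity.measurable_floor_norm f
  refine (hs.mapL S).unique ?_
  convert hs.mapL T using 2 with n
  have hm := ResolutionOfIdentity.measurable_floor_norm (measurableSet_singleton n)
  refine h _ (ResolutionOfIdentity.mem_domain_of_proj_eq (shiftResolution_isSpectralIntegral c)
    hm (ResolutionOfIdentity.isBounded_floor_norm n) ?_)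
  rw [(shiftResolution c).proj_proj hm hm, Set.inter_self]

/-! ### Translations -/

/-- The translation `f ↦ f (· - a)` on `ℍ_c`. -/
def weightedTranslate (c a : ℝ) : WeightedL2 c →L[ℂ] WeightedL2 c :=
  ((Real.exp (-(c * a)) : ℝ) : ℂ) • (((weightEquiv c).symm : Lp ℂ 2 volume →L[ℂ] WeightedL2 c) ∘L
    (translateL2 a).toContinuousLinearMap ∘L (weightEquiv c : WeightedL2 c →L[ℂ] Lp ℂ 2 volume))

theorem weightEquiv_weightedTranslate (a : ℝ) (f : WeightedL2 c) :
    weightEquiv c (weightedTranslate c a f) =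
      ((Real.exp (-(c * a)) : ℝ) : ℂ) • translateL2 a (weightEquiv c f) := by
  rw [weightedTranslate, _root_.smul_apply, map_smul]
  congr 1
  exact (weightEquiv c).apply_symm_apply _

/-- From $e^{-ct}f(t-a)=e^{-ca}\,e^{-c(t-a)}f(t-a)$, translation on $\mathbb H_c$ is $e^{-ca}$ times
an isometry; $a=\log n$ gives the summable bound $n^{-c}$. -/
theorem norm_weightedTranslate_le (c a : ℝ) : ‖weightedTranslate c a‖ ≤ Real.exp (-(c * a)) := by
  refine ContinuousLinearMap.opNorm_le_bound _ (Real.exp_pos _).le fun f => ?_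
  rw [← (weightEquiv c).norm_map, weightEquiv_weightedTranslate, norm_smul,
    LinearIsometry.norm_map, LinearIsometryEquiv.norm_map, Complex.norm_real,
    Real.norm_of_nonneg (Real.exp_pos _).le]

theorem coeFn_weightedTranslate (a : ℝ) (f : WeightedL2 c) :
    weightedTranslate c a f =ᵐ[volume] fun t => f (t - a) := by
  have h1 := coeFn_weightEquiv (weightedTranslate c a f)
  rw [weightEquiv_weightedTranslate] at h1
  filter_upwards [h1, Lp.coeFn_smul ((Real.exp (-(c * a)) : ℝ) : ℂ)
    (translateL2 a (weightEquiv c f)), coeFn_translateL2 a (weightEquiv c f),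
    (measurePreserving_sub_right volume a).quasiMeasurePreserving.ae (coeFn_weightEquiv f)]
    with t h1 h2 h3 h4
  rw [h2, Pi.smul_apply, h3, h4, smul_eq_mul, ← mul_assoc, Complex.ofReal_exp,
    ← Complex.exp_add] at h1
  refine mul_left_cancel₀ (Complex.exp_ne_zero (-(c * t))) (h1.symm.trans ?_)
  congr 2
  push_cast
  ring

open FourierTransform in
theorem fourierWeightEquiv_weightedTranslate (a : ℝ) (f : WeightedL2 c) :
    fourierWeightEquiv c (weightedTranslate c a f) =ᵐ[volume]
      fun ξ => Complex.exp (-(a * shiftSymbol c ξ)) * fourierWeightEquiv c f ξ := by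
  have h : fourierWeightEquiv c (weightedTranslate c a f) = ((Real.exp (-(c * a)) : ℝ) : ℂ) •
      (𝓕 (translateL2 a (weightEquiv c f)) : Lp ℂ 2 (volume : Measure ℝ)) := by
    change Lp.fourierTransformₗᵢ ℝ ℂ (weightEquiv c (weightedTranslate c a f)) = _
    rw [weightEquiv_weightedTranslate, map_smul]
    rfl
  rw [h]
  filter_upwards [Lp.coeFn_smul ((Real.exp (-(c * a)) : ℝ) : ℂ)
    (𝓕 (translateL2 a (weightEquiv c f)) : Lp ℂ 2 (volume : Measure ℝ)),
    fourier_translateL2 a (weightEquiv c f)] with ξ h1 h2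
  rw [h1, Pi.smul_apply, h2, smul_eq_mul, ← mul_assoc, Complex.ofReal_exp, ← Complex.exp_add]
  have h3 : (𝓕 (weightEquiv c f) : Lp ℂ 2 (volume : Measure ℝ)) = fourierWeightEquiv c f := rfl
  rw [h3]
  -- The weight factor and the Fourier phase combine: $e^{-ca}e^{-2\pi ia\xi}=e^{-a(c+2\pi i\xi)}$,
  -- so translation by $a$ is $e^{-a\partial_c}$.
  congr 2
  rw [shiftSymbol]
  push_cast
  ring

/-- The operator `n^{-∂_c}`. -/
def natPowShift (c : ℝ) (n : ℕ+) : WeightedL2 c →L[ℂ] WeightedL2 c :=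
  weightedTranslate c (Real.log ((n : ℕ) : ℝ))

theorem natCast_cpow_neg (n : ℕ+) (s : ℂ) :
    ((n : ℕ) : ℂ) ^ (-s) = Complex.exp (-((Real.log ((n : ℕ) : ℝ) : ℝ) * s)) := by
  rw [Complex.cpow_def_of_ne_zero (by exact_mod_cast n.ne_zero), ← Complex.natCast_log]
  congr 1; ring

theorem norm_natCast_cpow_neg (n : ℕ+) (s : ℂ) :
    ‖((n : ℕ) : ℂ) ^ (-s)‖ = ((n : ℕ) : ℝ) ^ (-s.re) := by
  rw [Complex.norm_natCast_cpow_of_pos n.pos, Complex.neg_re]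

theorem norm_natPowShift_le (n : ℕ+) : ‖natPowShift c n‖ ≤ ((n : ℕ) : ℝ) ^ (-c) := by
  refine (norm_weightedTranslate_le _ _).trans_eq ?_
  rw [Real.rpow_def_of_pos (by exact_mod_cast n.pos)]
  congr 1; ring

theorem measurable_natCast_cpow_neg (n : ℕ+) : Measurable fun s : ℂ => ((n : ℕ) : ℂ) ^ (-s) := by
  simp only [natCast_cpow_neg]; fun_prop

theorem isSpectralIntegral_natPowShift (n : ℕ+) :
    (shiftResolution c).IsSpectralIntegral (fun s => ((n : ℕ) : ℂ) ^ (-s))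
      (boundedAsPartial (natPowShift c n)) := by
  refine multiplicationResolution_isSpectralIntegral _ _ (measurable_natCast_cpow_neg n)
    (fun f _ => Submodule.mem_top) fun f => ?_
  filter_upwards [fourierWeightEquiv_weightedTranslate (Real.log ((n : ℕ) : ℝ)) (f : WeightedL2 c)]
    with ξ hξ
  rw [natCast_cpow_neg]
  exact hξ

theorem inner_natPowShift (n : ℕ+) (f : WeightedL2 c) :
    ⟪f, natPowShift c n f⟫_ℂ = ∫ s, ((n : ℕ) : ℂ) ^ (-s) ∂((shiftResolution c).scalarMeasure f) :=
  (isSpectralIntegral_natPowShift n).2 ⟨f, Submodule.mem_top⟩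

/-! ### The zeta function of the infinitesimal shift -/

theorem summable_pnat_rpow_neg (hc : 1 < c) : Summable fun n : ℕ+ => ((n : ℕ) : ℝ) ^ (-c) :=
  (Real.summable_nat_rpow.2 (by linarith)).comp_injective PNat.coe_injective

theorem hasSum_riemannZeta {s : ℂ} (hs : 1 < s.re) :
    HasSum (fun n : ℕ+ => ((n : ℕ) : ℂ) ^ (-s)) (riemannZeta s) := by
  have hsum : Summable fun n : ℕ+ => ((n : ℕ) : ℂ) ^ (-s) :=
    (summable_pnat_rpow_neg hs).of_norm_bounded fun n => (norm_natCast_cpow_neg n s).le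
  convert hsum.hasSum using 1
  rw [zeta_eq_tsum_one_div_nat_add_one_cpow hs, ← Equiv.pnatEquivNat.symm.tsum_eq]
  refine tsum_congr fun n => ?_
  simp [Complex.cpow_neg, Equiv.pnatEquivNat]

/-- Continuity off the pole suffices; the value assigned at $s=1$ does not matter. -/
theorem measurable_riemannZeta : Measurable riemannZeta :=
  measurable_of_continuousOn_compl_singleton 1 fun _ hs =>
    (differentiableAt_riemannZeta hs).continuousAt.continuousWithinAt

theorem summable_natPowShift (hc : 1 < c) : Summable (natPowShift c) :=
  (summable_pnat_rpow_neg hc).of_norm_bounded fun n => norm_natPowShift_le n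

/-- The operator `∑ n^{-∂_c}`. -/
def zetaShift (c : ℝ) : WeightedL2 c →L[ℂ] WeightedL2 c := ∑' n, natPowShift c n

theorem hasSum_natPowShift (hc : 1 < c) : HasSum (natPowShift c) (zetaShift c) :=
  (summable_natPowShift hc).hasSum

theorem hasSum_natPowShift_apply (hc : 1 < c) (f : WeightedL2 c) :
    HasSum (fun n => natPowShift c n f) (zetaShift c f) :=
  (hasSum_natPowShift hc).mapL (ContinuousLinearMap.apply ℂ (WeightedL2 c) f)

/-- On $\mathrm{Re}\,s=c$ the bound $|\zeta(s)|\le\sum n^{-c}$ makes the domain the whole space, and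
the same bound on the finite scalar measure justifies exchanging sum and integral in the quadratic
form. -/
theorem isSpectralIntegral_zetaShift (hc : 1 < c) :
    (shiftResolution c).IsSpectralIntegral riemannZeta (boundedAsPartial (zetaShift c)) := by
  have hsum := summable_pnat_rpow_neg hc
  refine ⟨fun f => ⟨fun _ => ?_, fun _ => Submodule.mem_top⟩, fun f => ?_⟩
  · refine MemLp.of_bound measurable_riemannZeta.aestronglyMeasurable
      (∑' n : ℕ+, ((n : ℕ) : ℝ) ^ (-c)) ?_
    filter_upwards [ae_re_eq f] with s hs
    rw [← (hasSum_riemannZeta (hs.symm ▸ hc)).tsum_eq]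
    exact tsum_of_norm_bounded hsum.hasSum fun n => by rw [norm_natCast_cpow_neg, hs]
  · set ν := (shiftResolution c).scalarMeasure (f : WeightedL2 c) with hν
    have hbound : ∀ n : ℕ+, ∀ᵐ s ∂ν, ‖((n : ℕ) : ℂ) ^ (-s)‖ = ((n : ℕ) : ℝ) ^ (-c) := fun n => by
      filter_upwards [ae_re_eq (f : WeightedL2 c)] with s hs
      rw [norm_natCast_cpow_neg, hs]
    have hint : ∀ n : ℕ+, Integrable (fun s : ℂ => ((n : ℕ) : ℂ) ^ (-s)) ν := fun n =>
      Integrable.of_bound (measurable_natCast_cpow_neg n).aestronglyMeasurable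
        (((n : ℕ) : ℝ) ^ (-c)) ((hbound n).mono fun _ h => h.le)
    have h1 := hasSum_integral_of_summable_integral_norm hint (by
      refine (hsum.mul_left (ν.real Set.univ)).congr fun n => ?_
      rw [integral_congr_ae (hbound n), integral_const, smul_eq_mul])
    have h2 : ∫ s, (∑' n : ℕ+, ((n : ℕ) : ℂ) ^ (-s)) ∂ν = ∫ s, riemannZeta s ∂ν := by
      refine integral_congr_ae ?_
      filter_upwards [ae_re_eq (f : WeightedL2 c)] with s hs
      exact (hasSum_riemannZeta (hs.symm ▸ hc)).tsum_eq
    rw [h2] at h1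
    have h3 := (hasSum_natPowShift_apply hc (f : WeightedL2 c)).mapL (innerSL ℂ (f : WeightedL2 c))
    simp only [innerSL_apply_apply, inner_natPowShift] at h3
    exact h3.unique h1

/-- Summability of the norms in $\mathbb H_c$ gives convergence almost everywhere to the same sum.
`HasSum` in $\mathbb C$ is unconditional, hence absolute, convergence. -/
theorem hasSum_translates (hc : 1 < c) (f : WeightedL2 c) : ∀ᵐ t : ℝ,
    HasSum (fun n : ℕ+ => f (t - Real.log ((n : ℕ) : ℝ))) (zetaShift c f t) := by
  have hnorm : Summable fun n : ℕ+ => ‖natPowShift c n f‖ :=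
    ((summable_pnat_rpow_neg hc).mul_right ‖f‖).of_nonneg_of_le (fun _ => norm_nonneg _) fun n =>
      (natPowShift c n).le_of_opNorm_le (norm_natPowShift_le n) f
  have h := Lp.hasSum_coeFn_tsum (f := fun n : ℕ+ => natPowShift c n f)
    (tsum_enorm_ne_top_iff_summable_norm.2 hnorm)
  rw [(hasSum_natPowShift_apply hc f).tsum_eq, ae_weightMeasure] at h
  have h2 : ∀ᵐ t : ℝ, ∀ n : ℕ+, natPowShift c n f t = f (t - Real.log ((n : ℕ) : ℝ)) :=
    ae_all_iff.2 fun n => coeFn_weightedTranslate _ f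
  filter_upwards [h, h2] with t h3 h4
  simpa only [h4] using h3

end

theorem theorem3p5 (c : ℝ) (hc : 1 < c) :
    -- `A` is the unique bounded extension of the spectral operator
    ∃ A : WeightedL2 c →L[ℂ] WeightedL2 c,
      spectralOperator c ≤ boundedAsPartial A ∧
      (∀ A' : WeightedL2 c →L[ℂ] WeightedL2 c,
        spectralOperator c ≤ boundedAsPartial A' → A' = A) ∧
      -- `A = ζ(∂_c)`
      functionOfOperator (infinitesimalShift c) riemannZeta = boundedAsPartial A ∧
      -- `A = ∑ n^{-∂_c}`, with bounded terms and convergence in operator norm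
      (∃ N : ℕ+ → (WeightedL2 c →L[ℂ] WeightedL2 c),
        (∀ n : ℕ+, functionOfOperator (infinitesimalShift c) (fun s : ℂ => ((n : ℕ) : ℂ) ^ (-s)) =
          boundedAsPartial (N n)) ∧
        HasSum N A ∧
        -- the series of translates converges to `A f` in `ℍ_c`
        ∀ f : WeightedL2 c,
          (∀ n : ℕ+, ∀ᵐ t : ℝ, N n f t = f (t - Real.log ((n : ℕ) : ℝ))) ∧
          HasSum (fun n : ℕ+ => N n f) (A f)) ∧
      -- the series of translates converges to `A f` almost everywhere
      ∀ f : WeightedL2 c, ∀ᵐ t : ℝ,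
        HasSum (fun n : ℕ+ => f (t - Real.log ((n : ℕ) : ℝ))) (A f t) := by
  have hζ : functionOfOperator (infinitesimalShift c) riemannZeta =
      boundedAsPartial (zetaShift c) :=
    functionOfOperator_infinitesimalShift (isSpectralIntegral_zetaShift hc)
  have hle : spectralOperator c ≤ boundedAsPartial (zetaShift c) :=
    LinearPMap.domRestrict_le.trans_eq hζ
  refine ⟨zetaShift c, hle, fun A' hA' => ?_, hζ, ⟨natPowShift c,
    fun n => functionOfOperator_infinitesimalShift (isSpectralIntegral_natPowShift n),
    hasSum_natPowShift hc, fun f => ⟨fun n => coeFn_weightedTranslate _ f,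
      hasSum_natPowShift_apply hc f⟩⟩, hasSum_translates hc⟩
  refine eq_of_eqOn_domain fun f hf => ?_
  -- As $\zeta(\partial_c)$ is defined everywhere, the restriction has all of $D(\partial_c)$ as its
  -- domain.
  have hdom : f ∈ (spectralOperator c).domain := by
    rw [spectralOperator, hζ]
    exact ⟨hf, Submodule.mem_top⟩
  have h1 := hA'.2 (x := ⟨f, hdom⟩) (y := ⟨f, Submodule.mem_top⟩) rfl
  have h2 := hle.2 (x := ⟨f, hdom⟩) (y := ⟨f, Submodule.mem_top⟩) rfl
  exact h1.symm.trans h2
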